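/- Let $\phi,\psi\in L^2(\mathbb R)$ with $\overline\phi,\psi\in H_2^+(\mathbb R)$, where $H_2^+(\mathbb R)\subset L^2(\mathbb R)$ is the Hardy space of boundary values of $L^2$-functions analytic in the upper half-plane. Write $\langle f,g\rangle=\int_{\mathbb R} f\overline g\,dx$. On the domain $$\mathrm{Dom}(A)=\mathrm{Dom}(\widetilde A)=\Big\{f\in L^2(\mathbb R):\ xf(x)\in L^2(\mathbb R),\ \lim_{R\to\infty}\int_{-R}^R f(x)\,dx=0\Big\}$$ put $(Af)(x)=xf(x)+\langle f,\phi\rangle\psi(x)$ and $(\widetilde Af)(x)=xf(x)+\langle f,\psi\rangle\phi(x)$. On $\mathrm{Dom}(\widetilde A^*)=\mathrm{Dom}(A^*)$ let $\Gamma_1u=\lim_{R\to\infty}\int_{-R}^R u(x)\,dx$ and $\Gamma_2u=c_u$, the unique constant with $xu(x)-c_u\in L^2(\mathbb R)$. For $B\in\mathbb C$ let $A_B=\widetilde A^*|_{\ker(\Gamma_1-B\Gamma_2)}$ and $\widetilde A_{B^*}=A^*|_{\ker(\Gamma_1-\overline B\,\Gamma_2)}$. For $\mu\in\rho(A_B)$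 let $S_{\mu,B}$ be the solution operator, i.e. $u=S_{\mu,B}f$ solves $(\widetilde A^*-\mu)u=0$, $(\Gamma_1-B\Gamma_2)u=f$; for $\mu\in\rho(\widetilde A_{B^*})$ let likewise $u=\widetilde S_{\mu,B^*}f$ solve $(A^*-\mu)u=0$, $(\Gamma_1-\overline B\,\Gamma_2)u=f$. For fixed $\mu_0\in\rho(A_B)$ and $\widetilde\mu\in\rho(\widetilde A_{B^*})$ put $$\mathcal S_B=\mathrm{Span}_{\delta\in\rho(A_B)}(A_B-\delta)^{-1}\mathrm{Ran}(S_{\mu_0,B}),\qquad \widetilde{\mathcal S}_{B^*}=\mathrm{Span}_{\delta\in\rho(\widetilde A_{B^*})}(\widetilde A_{B^*}-\delta)^{-1}\mathrm{Ran}(\widetilde S_{\widetilde\mu,B^*}),$$ and write $\mathrm{def}(\mathcal S)=\dim\mathcal S^\perp$. **Theorem.** Let $B\in\mathbb C$ with $B\neq-\pi i$. If $B=\pi i$, assume in addition that the model is non-trivial, i.e. $\phi\neq0$ and $\psi\neq0$. Then: 1. $\rho(A_B)\neq\emptyset$ and, for every $\mu_0\in\rho(A_B)$, $\mathrm{def}(\mathcal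 S_B)=0$, i.e. the detectable subspace $\overline{\mathcal S_B}$ is all of $L^2(\mathbb R)$. 2. $\rho(\widetilde A_{B^*})\neq\emptyset$ and, for every $\widetilde\mu\in\rho(\widetilde A_{B^*})$, $\mathrm{def}(\widetilde{\mathcal S}_{B^*})=0$, i.e. $\overline{\widetilde{\mathcal S}_{B^*}}=L^2(\mathbb R)$. -/

import Mathlib

open MeasureTheory Filter Topology Complex
open scoped ComplexConjugate ENNReal NNReal

namespace Friedrichs

noncomputable section

/-- The Hilbert space `L²(ℝ)` of complex-valued functions.
Mathlib's `inner ℂ φ f` is `∫ f * conj φ`, that is `⟨f, φ⟩` when the inner product is written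
linear in its first argument. -/
abbrev L2 : Type := Lp ℂ 2 (volume : Measure ℝ)

/-- `f` belongs to the Hardy space `H₂⁺(ℝ)`: it is the boundary value (in `L²`, as `y → 0+`) of a
function `F` holomorphic in the upper half-plane whose restrictions to the horizontal lines are
bounded in `L²`. -/
def MemHardyPlus (f : ℝ → ℂ) : Prop :=
  MemLp f 2 volume ∧
  ∃ F : ℂ → ℂ, DifferentiableOn ℂ F {z : ℂ | 0 < z.im} ∧
    (∃ C : ℝ≥0, ∀ y : ℝ, 0 < y →
      eLpNorm (fun x : ℝ => F ((x : ℂ) + (y : ℂ) * I)) 2 volume ≤ (C : ℝ≥0∞)) ∧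
    Tendsto (fun y : ℝ => eLpNorm (fun x : ℝ => F ((x : ℂ) + (y : ℂ) * I) - f x) 2 volume)
      (𝓝[>] (0 : ℝ)) (𝓝 0)

/-- `Γ₁ u = a`: the principal value integral `lim_{R → ∞} ∫_{-R}^{R} u` exists and equals `a`. -/
def TraceOne (u : L2) (a : ℂ) : Prop :=
  Tendsto (fun R : ℝ => ∫ x in (-R)..R, u x) atTop (𝓝 a)

/-- `Γ₂ u = c`: the function `x u(x) - c` is square integrable
(there is at most one such `c`, the constant `c_u`). -/
def TraceTwo (u : L2) (c : ℂ) : Prop :=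
  MemLp (fun x : ℝ => (x : ℂ) * u x - c) 2 volume

lemma intervalIntegrable_L2 (u : L2) (a b : ℝ) : IntervalIntegrable u volume a b := by
  have h := (Lp.memLp u).locallyIntegrable (by norm_num)
  exact (h.integrableOn_isCompact isCompact_uIcc).intervalIntegrable

lemma TraceOne.zero : TraceOne 0 0 := by
  have h : (fun R : ℝ => ∫ x in (-R)..R, (0 : L2) x) = fun _ => (0 : ℂ) := by
    funext R
    rw [intervalIntegral.integral_congr_ae (g := fun _ => (0 : ℂ))]
    · simp
    · filter_upwards [Lp.coeFn_zero ℂ 2 (volume : Measure ℝ)] with x hx _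
      simp
  unfold TraceOne
  rw [h]
  exact tendsto_const_nhds

lemma TraceOne.add {u v : L2} {a b : ℂ} (hu : TraceOne u a) (hv : TraceOne v b) :
    TraceOne (u + v) (a + b) := by
  refine (Tendsto.add hu hv).congr fun R => ?_
  rw [← intervalIntegral.integral_add (intervalIntegrable_L2 u _ _) (intervalIntegrable_L2 v _ _)]
  refine intervalIntegral.integral_congr_ae ?_
  filter_upwards [Lp.coeFn_add u v] with x hx _
  simpa using hx.symm

lemma TraceOne.smul {u : L2} {a : ℂ} (k : ℂ) (hu : TraceOne u a) :
    TraceOne (k • u) (k * a) := by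
  refine (Tendsto.const_mul k hu).congr fun R => ?_
  rw [← intervalIntegral.integral_const_mul]
  refine intervalIntegral.integral_congr_ae ?_
  filter_upwards [Lp.coeFn_smul k u] with x hx _
  simpa using hx.symm

lemma TraceTwo.zero : TraceTwo 0 0 := by
  refine (MemLp.zero (ε := ℂ)).ae_eq ?_
  filter_upwards [Lp.coeFn_zero ℂ 2 (volume : Measure ℝ)] with x hx
  simp

lemma TraceTwo.add {u v : L2} {a b : ℂ} (hu : TraceTwo u a) (hv : TraceTwo v b) :
    TraceTwo (u + v) (a + b) := by
  refine (MemLp.add hu hv).ae_eq ?_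
  filter_upwards [Lp.coeFn_add u v] with x hx
  simp only [Pi.add_apply, hx]
  ring

lemma TraceTwo.smul {u : L2} {a : ℂ} (k : ℂ) (hu : TraceTwo u a) :
    TraceTwo (k • u) (k * a) := by
  refine (MemLp.const_smul hu k).ae_eq ?_
  filter_upwards [Lp.coeFn_smul k u] with x hx
  simp only [Pi.smul_apply, hx, smul_eq_mul]
  ring

/-- The domain of `A`: all `f ∈ L²` with `x f(x) ∈ L²` and `lim_{R → ∞} ∫_{-R}^{R} f = 0`. -/
def minDomain : Submodule ℂ L2 where
  carrier := {f | MemLp (fun x : ℝ => (x : ℂ) * f x) 2 volume ∧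
    Tendsto (fun R : ℝ => ∫ x in (-R)..R, f x) atTop (𝓝 0)}
  zero_mem' := ⟨by simp, TraceOne.zero⟩
  add_mem' := fun {f g} hf hg => by
    refine ⟨?_, by simpa [TraceOne] using TraceOne.add hf.2 hg.2⟩
    have h := TraceTwo.add (u := f) (v := g) (a := 0) (b := 0)
      (by simpa [TraceTwo] using hf.1) (by simpa [TraceTwo] using hg.1)
    simpa [TraceTwo] using h
  smul_mem' := fun k f hf => by
    refine ⟨?_, by simpa [TraceOne] using TraceOne.smul k hf.2⟩
    have h := TraceTwo.smul (u := f) (a := 0) k (by simpa [TraceTwo] using hf.1)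
    simpa [TraceTwo] using h

/-- Multiplication by the independent variable on `minDomain`. -/
def mulX : minDomain →ₗ[ℂ] L2 where
  toFun f := MemLp.toLp (fun x : ℝ => (x : ℂ) * (f : L2) x) f.2.1
  map_add' f g := by
    rw [← MemLp.toLp_add]
    refine MemLp.toLp_congr _ _ ?_
    filter_upwards [Lp.coeFn_add (f : L2) (g : L2)] with x hx
    simp only [Submodule.coe_add, Pi.add_apply, hx]
    ring
  map_smul' k f := by
    rw [RingHom.id_apply, ← MemLp.toLp_const_smul]
    refine MemLp.toLp_congr _ _ ?_
    filter_upwards [Lp.coeFn_smul k (f : L2)] with x hx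
    simp only [Submodule.coe_smul, Pi.smul_apply, hx, smul_eq_mul]
    ring

/-- The Friedrichs model operator `(A f)(x) = x f(x) + ⟨f, φ⟩ ψ(x)` with domain `minDomain`.
The operator `Ã` is the same with `φ` and `ψ` exchanged, i.e. `minOp ψ φ`. -/
def minOp (φ ψ : L2) : L2 →ₗ.[ℂ] L2 where
  domain := minDomain
  toFun := mulX + ((innerₛₗ ℂ φ).comp minDomain.subtype).smulRight ψ

/-- The maximal operator `Ã*`, the Hilbert space adjoint of `Ã`.
Exchanging `φ` and `ψ` gives `A* = maxOp ψ φ`. -/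
def maxOp (φ ψ : L2) : L2 →ₗ.[ℂ] L2 := (minOp ψ φ).adjoint

/-- The boundary condition `Γ₁ u = B Γ₂ u`. -/
def boundaryCondition (B : ℂ) : Submodule ℂ L2 where
  carrier := {u | ∃ a c : ℂ, TraceOne u a ∧ TraceTwo u c ∧ a - B * c = 0}
  zero_mem' := ⟨0, 0, TraceOne.zero, TraceTwo.zero, by simp⟩
  add_mem' := by
    rintro u v ⟨a, c, ha, hc, h⟩ ⟨a', c', ha', hc', h'⟩
    exact ⟨a + a', c + c', ha.add ha', hc.add hc', by linear_combination h + h'⟩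
  smul_mem' := by
    rintro k u ⟨a, c, ha, hc, h⟩
    exact ⟨k * a, k * c, ha.smul k, hc.smul k, by linear_combination k * h⟩

/-- The extension `A_B` of `A`: the restriction of `Ã*` to `ker (Γ₁ - B Γ₂)`.
Exchanging `φ` and `ψ` gives the extensions of `Ã`: `Ã_C = extOp ψ φ C`, the restriction
of `A*` to `ker (Γ₁ - C Γ₂)`. -/
def extOp (φ ψ : L2) (B : ℂ) : L2 →ₗ.[ℂ] L2 := (maxOp φ ψ).domRestrict (boundaryCondition B)

/-- The bounded operator `R` is the resolvent `(T - z)⁻¹` of the unbounded operator `T`. -/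
def IsResolventAt (T : L2 →ₗ.[ℂ] L2) (z : ℂ) (R : L2 →L[ℂ] L2) : Prop :=
  (∀ f : L2, ∃ h : R f ∈ T.domain, T ⟨R f, h⟩ - z • R f = f) ∧
  (∀ u : T.domain, R (T u - z • (u : L2)) = u)

/-- The resolvent set `ρ(T)`, the complement of the spectrum `σ(T)`. -/
def resolventSet (T : L2 →ₗ.[ℂ] L2) : Set ℂ := {z | ∃ R : L2 →L[ℂ] L2, IsResolventAt T z R}

/-- `u = S_{μ,B} f` for the solution operator `S_{μ,B}`:
`(Ã* - μ) u = 0` and `(Γ₁ - B Γ₂) u = f`. -/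
def IsSolution (φ ψ : L2) (B μ f : ℂ) (u : L2) : Prop :=
  (∃ h : u ∈ (maxOp φ ψ).domain, maxOp φ ψ ⟨u, h⟩ - μ • u = 0) ∧
  ∃ a c : ℂ, TraceOne u a ∧ TraceTwo u c ∧ a - B * c = f

/-- The range of the solution operator `S_{μ,B}`. -/
def solutionRange (φ ψ : L2) (B μ : ℂ) : Set L2 := {u | ∃ f : ℂ, IsSolution φ ψ B μ f u}

/-- The space `S_B = Span_{δ ∉ σ(A_B)} (A_B - δ)⁻¹ Ran S_{μ₀,B}`, for a fixed `μ₀ ∉ σ(A_B)`; its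
closure is the detectable subspace. Exchanging `φ` and `ψ` gives the space belonging to `Ã_C`. -/
def detectableSpan (φ ψ : L2) (B μ₀ : ℂ) : Submodule ℂ L2 :=
  Submodule.span ℂ {v | ∃ (δ : ℂ) (R : L2 →L[ℂ] L2), IsResolventAt (extOp φ ψ B) δ R ∧
    ∃ u ∈ solutionRange φ ψ B μ₀, v = R u}

/-- The defect `def S = dim S^⊥`, as a cardinal. -/
def defect (S : Submodule ℂ L2) : Cardinal := Module.rank ℂ Sᗮ

end

end Friedrichs

/-! Take g orthogonal to the detectable span and put G = conj g. If u_m and u_δ are the normalised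
solutions at m and δ (those with (Γ₁ - BΓ₂)u = 1), then (m - δ)(A_B - δ)⁻¹u_m = u_m - u_δ
(`resolvent_apply_of_isSolution`). Orthogonality therefore says that ∫ G u_δ does not depend on δ in
the resolvent set. The proof evaluates this constant in the two half-planes, writing ĥ(l) = ∫
h(x)/(x - l) dx.

The Hardy hypotheses are used only in the form that the Cauchy integrals of conj φ and ψ vanish in
the lower half-plane (`MemHardyPlus.integral_eq_zero`). There the rank-one perturbation drops out:
the determinant governing the resolvent is the nonzero constant -πi - B, and u_l is a multiple of
1/(x - l). The norm of 1/(x - l) tends to 0 as l goes to -i∞, so the constant is 0. Hence Ĝ vanishes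
in the lower half-plane, and G lies in the same class as conj φ and ψ.

For h, w in this class the Cauchy integral is multiplicative in the upper half-plane: 2πi ∫ h w/(x -
l) = ĥ(l) ŵ(l) (`CauchyVanishes.pairing_divSub`). Inserted into the formula for u_l, it cancels the
cross terms and leaves 0 = ∫ G u_l = Ĝ(l)/D(l) wherever D(l) ≠ 0. It also makes the determinant D
explicit, and D is not identically zero: letting l go to i∞ forces B = πi, in which case D is minus
the product of the transforms of conj φ and ψ, nonzero somewhere by non-triviality and the identity
theorem. So Ĝ vanishes on an open set, hence on the whole upper half-plane, and G = 0 because the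
Cauchy kernels are total in L² (`eq_zero_of_pairing_resolventKernel`).

The adjoint statement is the mirror image: exchanging φ with ψ and B with its conjugate swaps the
half-planes. A sign s = ±1 treats both cases at once. -/

namespace Friedrichs

/-! ### The bilinear pairing on L². -/

/-- The bilinear pairing `∫ h f` on `L²(ℝ)`, as a continuous functional of `f`. -/
noncomputable def pairing (h : L2) : L2 →L[ℂ] ℂ := innerSL ℂ (star h)

lemma pairing_apply (h f : L2) : pairing h f = ∫ x : ℝ, h x * f x := by
  rw [pairing, innerSL_apply_apply, L2.inner_def]
  refine integral_congr_ae ?_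
  filter_upwards [Lp.coeFn_star h] with x hx
  simp [hx, mul_comm]

lemma pairing_comm (h f : L2) : pairing h f = pairing f h := by
  simp only [pairing_apply, mul_comm]

lemma inner_eq_pairing (g f : L2) : inner ℂ g f = pairing (star g) f := by
  rw [pairing, innerSL_apply_apply, star_star]

lemma pairing_star_star (h f : L2) : pairing (star h) (star f) = conj (pairing h f) := by
  rw [pairing_apply, pairing_apply, ← integral_conj]
  refine integral_congr_ae ?_
  filter_upwards [Lp.coeFn_star h, Lp.coeFn_star f] with x hx hx'
  simp [hx, hx']

lemma norm_pairing_le (h f : L2) : ‖pairing h f‖ ≤ ‖h‖ * ‖f‖ := by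
  have : ‖star h‖ = ‖h‖ := by
    simp only [Lp.norm_def]
    congr 1
    rw [eLpNorm_congr_ae (Lp.coeFn_star h), eLpNorm_star]
  rw [pairing, innerSL_apply_apply, ← this]
  exact norm_inner_le_norm _ _

lemma integrable_mul_L2 (h f : L2) : Integrable (fun x : ℝ => h x * f x) :=
  (Lp.memLp h).integrable_mul (Lp.memLp f)

/-! ### Cauchy kernels, multiplication by 1/(x - l), and their traces. -/

lemma sub_ne_zero_of_im {l : ℂ} (hl : l.im ≠ 0) (x : ℝ) : (x : ℂ) - l ≠ 0 := by
  intro h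
  apply hl
  have := congrArg Complex.im h
  simpa using this

lemma continuous_resolventKernel {l : ℂ} (hl : l.im ≠ 0) :
    Continuous fun x : ℝ => ((x : ℂ) - l)⁻¹ :=
  (by fun_prop : Continuous fun x : ℝ => (x : ℂ) - l).inv₀ (sub_ne_zero_of_im hl)

lemma norm_resolventKernel_le {l : ℂ} (hl : l.im ≠ 0) (x : ℝ) :
    ‖((x : ℂ) - l)⁻¹‖ ≤ |l.im|⁻¹ := by
  rw [norm_inv]
  refine inv_anti₀ (abs_pos.2 hl) ?_
  have := Complex.abs_im_le_norm ((x : ℂ) - l)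
  simpa using this

lemma memLp_resolventKernel {l : ℂ} (hl : l.im ≠ 0) :
    MemLp (fun x : ℝ => ((x : ℂ) - l)⁻¹) 2 volume := by
  rw [memLp_two_iff_integrable_sq_norm (continuous_resolventKernel hl).aestronglyMeasurable]
  have h := ((integrable_inv_one_add_sq.comp_div hl).comp_sub_right l.re).const_mul ((l.im ^ 2)⁻¹)
  refine h.congr (ae_of_all _ fun x => ?_)
  have h2 : ‖(x : ℂ) - l‖ ^ 2 = (x - l.re) ^ 2 + l.im ^ 2 := by
    rw [Complex.sq_norm, Complex.normSq_apply]
    simp; ring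
  have h3 : (x - l.re) ^ 2 + l.im ^ 2 ≠ 0 := by positivity
  simp only [norm_inv, inv_pow, h2]
  field_simp
  ring

open Classical in
/-- The function `1 / (x - l)`, for non-real `l`, as an element of `L²(ℝ)`. -/
noncomputable def resolventKernel (l : ℂ) : L2 :=
  if hl : l.im ≠ 0 then (memLp_resolventKernel hl).toLp _ else 0

lemma coeFn_resolventKernel {l : ℂ} (hl : l.im ≠ 0) :
    resolventKernel l =ᵐ[volume] fun x : ℝ => ((x : ℂ) - l)⁻¹ := by
  rw [resolventKernel, dif_pos hl]
  exact MemLp.coeFn_toLp _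

lemma memLp_divSub {l : ℂ} (hl : l.im ≠ 0) (f : L2) :
    MemLp (fun x : ℝ => ((x : ℂ) - l)⁻¹ * f x) 2 volume := by
  refine (Lp.memLp f).of_le_mul (c := |l.im|⁻¹)
    ((continuous_resolventKernel hl).aestronglyMeasurable.mul (Lp.aestronglyMeasurable f))
    (ae_of_all _ fun x => ?_)
  rw [norm_mul]
  gcongr
  exact norm_resolventKernel_le hl x

open Classical in
/-- Multiplication by `1 / (x - l)`, for non-real `l`, as a bounded operator on `L²(ℝ)`. -/
noncomputable def divSub (l : ℂ) : L2 →L[ℂ] L2 :=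
  if hl : l.im ≠ 0 then
    LinearMap.mkContinuous
      { toFun := fun f => (memLp_divSub hl f).toLp _
        map_add' := fun f g => by
          rw [← MemLp.toLp_add]
          refine MemLp.toLp_congr _ _ ?_
          filter_upwards [Lp.coeFn_add f g] with x hx
          simp only [Pi.add_apply, hx, mul_add]
        map_smul' := fun k f => by
          rw [RingHom.id_apply, ← MemLp.toLp_const_smul]
          refine MemLp.toLp_congr _ _ ?_
          filter_upwards [Lp.coeFn_smul k f] with x hx
          simp only [Pi.smul_apply, smul_eq_mul, hx, mul_left_comm] } |l.im|⁻¹ fun f => by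
        refine Lp.norm_le_mul_norm_of_ae_le_mul ?_
        filter_upwards [(memLp_divSub hl f).coeFn_toLp] with x hx
        simp only [LinearMap.coe_mk, AddHom.coe_mk]
        rw [hx, norm_mul]
        gcongr
        exact norm_resolventKernel_le hl x
  else 0

lemma coeFn_divSub {l : ℂ} (hl : l.im ≠ 0) (f : L2) :
    divSub l f =ᵐ[volume] fun x : ℝ => ((x : ℂ) - l)⁻¹ * f x := by
  rw [divSub, dif_pos hl]
  exact (memLp_divSub hl f).coeFn_toLp

lemma pairing_divSub {l : ℂ} (hl : l.im ≠ 0) (h f : L2) :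
    pairing h (divSub l f) = pairing (divSub l h) f := by
  rw [pairing_apply, pairing_apply]
  refine integral_congr_ae ?_
  filter_upwards [coeFn_divSub hl h, coeFn_divSub hl f] with x hx hx'
  rw [hx, hx']
  ring

lemma integral_divSub {l : ℂ} (hl : l.im ≠ 0) (f : L2) :
    Integrable (divSub l f) ∧ ∫ x : ℝ, divSub l f x = pairing f (resolventKernel l) := by
  have h : (fun x : ℝ => f x * resolventKernel l x) =ᵐ[volume] divSub l f := by
    filter_upwards [coeFn_divSub hl f, coeFn_resolventKernel hl] with x hx hx'
    rw [hx, hx', mul_comm]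
  refine ⟨(integrable_mul_L2 _ _).congr h, ?_⟩
  rw [pairing_apply, integral_congr_ae h]

lemma traceOne_divSub {l : ℂ} (hl : l.im ≠ 0) (f : L2) :
    TraceOne (divSub l f) (pairing f (resolventKernel l)) := by
  rw [← (integral_divSub hl f).2]
  exact intervalIntegral_tendsto_integral (integral_divSub hl f).1 tendsto_neg_atTop_atBot
    tendsto_id

lemma traceTwo_divSub {l : ℂ} (hl : l.im ≠ 0) (f : L2) : TraceTwo (divSub l f) 0 := by
  refine (((Lp.memLp f).add ((Lp.memLp (divSub l f)).const_smul l))).ae_eq ?_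
  filter_upwards [coeFn_divSub hl f] with x hx
  have := sub_ne_zero_of_im hl x
  simp only [Pi.add_apply, Pi.smul_apply, smul_eq_mul, hx]
  field_simp
  ring

lemma traceTwo_resolventKernel {l : ℂ} (hl : l.im ≠ 0) : TraceTwo (resolventKernel l) 1 := by
  refine ((Lp.memLp (resolventKernel l)).const_smul l).ae_eq ?_
  filter_upwards [coeFn_resolventKernel hl] with x hx
  have := sub_ne_zero_of_im hl x
  simp only [Pi.smul_apply, smul_eq_mul, hx]
  field_simp
  ring

/-- Partial fractions. This resolvent identity underlies the norm, continuity and derivative of the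
kernel, and all later manipulation of Cauchy integrals. -/
lemma resolventKernel_sub {l m : ℂ} (hl : l.im ≠ 0) (hm : m.im ≠ 0) :
    resolventKernel l - resolventKernel m = (l - m) • divSub l (resolventKernel m) := by
  refine Lp.ext ?_
  filter_upwards [Lp.coeFn_sub (resolventKernel l) (resolventKernel m),
    Lp.coeFn_smul (l - m) (divSub l (resolventKernel m)), coeFn_divSub hl (resolventKernel m),
    coeFn_resolventKernel hl, coeFn_resolventKernel hm] with x h1 h2 h3 h4 h5
  have := sub_ne_zero_of_im hl x
  have := sub_ne_zero_of_im hm x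
  rw [h1, h2]
  simp only [Pi.sub_apply, Pi.smul_apply, smul_eq_mul, h3, h4, h5]
  field_simp
  ring

lemma divSub_resolventKernel_comm {l m : ℂ} (hl : l.im ≠ 0) (hm : m.im ≠ 0) :
    divSub l (resolventKernel m) = divSub m (resolventKernel l) := by
  refine Lp.ext ?_
  filter_upwards [coeFn_divSub hm (resolventKernel l), coeFn_divSub hl (resolventKernel m),
    coeFn_resolventKernel hl, coeFn_resolventKernel hm] with x h2 h3 h4 h5
  rw [h2, h3, h4, h5, mul_comm]

lemma star_resolventKernel {l : ℂ} (hl : l.im ≠ 0) :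
    star (resolventKernel l) = resolventKernel (conj l) := by
  have hl' : (conj l).im ≠ 0 := by simpa using hl
  refine Lp.ext ?_
  filter_upwards [Lp.coeFn_star (resolventKernel l), coeFn_resolventKernel hl,
    coeFn_resolventKernel hl'] with x h1 h2 h3
  rw [h1, Pi.star_apply, h2, h3]
  simp

/-! ### Principal values of the kernels and uniqueness of the traces. -/

/-- The principal value of `∫ dx / (x - l)` is `π i` for `l` in the upper half-plane. -/
lemma traceOne_resolventKernel_of_pos {l : ℂ} (hl : 0 < l.im) :
    TraceOne (resolventKernel l) (Real.pi * I) := by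
  have hF : ∀ R : ℝ, ∫ x in (-R)..R, resolventKernel l x
      = log ((R : ℂ) - l) - log ((R : ℂ) + l) + Real.pi * I := by
    intro R
    have h1 : ∫ x in (-R)..R, resolventKernel l x = ∫ x in (-R)..R, ((x : ℂ) - l)⁻¹ := by
      refine intervalIntegral.integral_congr_ae ?_
      filter_upwards [coeFn_resolventKernel hl.ne'] with x hx _
      exact hx
    have h2 : ∀ x : ℝ, HasDerivAt (fun x : ℝ => log ((x : ℂ) - l)) ((x : ℂ) - l)⁻¹ x := by
      intro x
      have hs : (x : ℂ) - l ∈ slitPlane := Or.inr (by simp [hl.ne'])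
      have := ((hasDerivAt_id (x : ℂ)).sub_const l).clog hs
      simpa using this.comp_ofReal
    rw [h1, intervalIntegral.integral_eq_sub_of_hasDerivAt (fun x _ => h2 x)
      ((continuous_resolventKernel hl.ne').intervalIntegrable _ _)]
    -- The term πi is the jump of the argument: R + l lies in the upper half-plane, so negating it
    -- lowers the principal argument by π. The remaining logarithms both behave like log R and
    -- cancel in the limit.
    have h3 : ((-R : ℝ) : ℂ) - l = -((R : ℂ) + l) := by push_cast; ring
    have h4 : 0 < ((R : ℂ) + l).im := by simpa using hl
    rw [h3, Complex.log, Complex.log, Complex.log, norm_neg, Complex.arg_neg_eq_arg_sub_pi_of_im_pos h4]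
    push_cast
    ring
  unfold TraceOne
  simp_rw [hF]
  have hinv : Tendsto (fun R : ℝ => ((R : ℂ))⁻¹) atTop (𝓝 0) := by
    have := (Complex.continuous_ofReal.tendsto 0).comp tendsto_inv_atTop_zero
    simpa [Function.comp_def] using this
  have hlog : ∀ m : ℂ, Tendsto (fun R : ℝ => log (1 + m * (R : ℂ)⁻¹)) atTop (𝓝 0) := by
    intro m
    have h := (continuousAt_clog (x := 1) (by simp)).tendsto.comp
      (show Tendsto (fun R : ℝ => 1 + m * (R : ℂ)⁻¹) atTop (𝓝 1) by
        simpa using (hinv.const_mul m).const_add 1)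
    simpa [Function.comp_def] using h
  have hsplit : ∀ m : ℂ, m.im ≠ 0 → ∀ R : ℝ, 0 < R →
      log ((R : ℂ) + m) = Real.log R + log (1 + m * (R : ℂ)⁻¹) := by
    intro m hm R hR
    rw [← Complex.log_ofReal_mul hR]
    · have hR' : (R : ℂ) ≠ 0 := by exact_mod_cast hR.ne'
      congr 1
      field_simp
    · intro h
      have h' := congrArg (fun z => ((R : ℂ) * z).im) h
      have hR' : (R : ℂ) ≠ 0 := by exact_mod_cast hR.ne'
      have : (R : ℂ) * (1 + m * (R : ℂ)⁻¹) = R + m := by field_simp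
      simp only [this] at h'
      simp at h'
      exact hm h'
  have h := (((hlog (-l)).sub (hlog l)).add_const ((Real.pi : ℂ) * I))
  rw [sub_zero, zero_add] at h
  refine h.congr' ?_
  filter_upwards [eventually_gt_atTop 0] with R hR
  rw [sub_eq_add_neg (R : ℂ) l, hsplit l hl.ne' R hR, hsplit (-l) (by simpa using hl.ne') R hR]
  ring

lemma TraceOne.star {u : L2} {a : ℂ} (hu : TraceOne u a) : TraceOne (star u) (conj a) := by
  refine ((Complex.continuous_conj.tendsto a).comp hu).congr fun R => ?_
  rw [Function.comp_apply, intervalIntegral, intervalIntegral, map_sub, ← integral_conj,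
    ← integral_conj]
  congr 1 <;>
  · refine integral_congr_ae (ae_restrict_of_ae ?_)
    filter_upwards [Lp.coeFn_star u] with x hx
    rw [hx]
    rfl

lemma traceOne_resolventKernel {s : ℝ} (hs : s = 1 ∨ s = -1) {l : ℂ} (hl : 0 < s * l.im) :
    TraceOne (resolventKernel l) (s * Real.pi * I) := by
  rcases hs with rfl | rfl
  · simpa using traceOne_resolventKernel_of_pos (by simpa using hl)
  · have hl' : 0 < (conj l).im := by simpa using hl
    have h := (traceOne_resolventKernel_of_pos hl').star
    rw [star_resolventKernel hl'.ne'] at h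
    simpa using h

lemma TraceOne.unique {u : L2} {a b : ℂ} (ha : TraceOne u a) (hb : TraceOne u b) : a = b :=
  tendsto_nhds_unique ha hb

lemma TraceTwo.unique {u : L2} {c d : ℂ} (hc : TraceTwo u c) (hd : TraceTwo u d) : c = d := by
  by_contra hne
  have h := MemLp.sub hd hc
  have h2 : MemLp (fun _ : ℝ => c - d) 2 volume := by
    refine h.ae_eq (ae_of_all _ fun x => ?_)
    simp
  rw [memLp_const_iff (by norm_num) (by norm_num)] at h2
  simp [sub_eq_zero, hne] at h2


lemma traceOne_sub {u v : L2} {a b : ℂ} (hu : TraceOne u a) (hv : TraceOne v b) :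
    TraceOne (u - v) (a - b) := by
  have h := hu.add (hv.smul (-1))
  convert h using 1
  · rw [neg_one_smul, sub_eq_add_neg]
  · ring

lemma traceTwo_sub {u v : L2} {a b : ℂ} (hu : TraceTwo u a) (hv : TraceTwo v b) :
    TraceTwo (u - v) (a - b) := by
  have h := hu.add (hv.smul (-1))
  convert h using 1
  · rw [neg_one_smul, sub_eq_add_neg]
  · ring

/-! ### Size, continuity and holomorphy of l ↦ 1/(x - l). -/

lemma mul_pairing_divSub_resolventKernel (h : L2) {l m : ℂ} (hl : l.im ≠ 0) (hm : m.im ≠ 0) :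
    (l - m) * pairing h (divSub l (resolventKernel m))
      = pairing h (resolventKernel l) - pairing h (resolventKernel m) := by
  rw [← map_sub, resolventKernel_sub hl hm, map_smul, smul_eq_mul]

/-- Partial fractions turn the absolutely convergent integral of a product of kernels into a
difference of principal values. -/
lemma mul_pairing_resolventKernel {l m a b : ℂ} (hl : l.im ≠ 0) (hm : m.im ≠ 0)
    (ha : TraceOne (resolventKernel l) a) (hb : TraceOne (resolventKernel m) b) :
    (l - m) * pairing (resolventKernel m) (resolventKernel l) = a - b := by
  have h := (traceOne_divSub hl (resolventKernel m)).smul (l - m)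
  rw [← resolventKernel_sub hl hm] at h
  exact h.unique (traceOne_sub ha hb)

lemma exists_sign {x : ℝ} (hx : x ≠ 0) : ∃ s : ℝ, (s = 1 ∨ s = -1) ∧ 0 < s * x := by
  rcases lt_or_gt_of_ne hx with h | h
  · exact ⟨-1, Or.inr rfl, by linarith⟩
  · exact ⟨1, Or.inl rfl, by linarith⟩

/-- On the real line the conjugate of 1/(x - l) is the kernel at conj l, so the squared norm is a
pairing of two kernels, whose principal values differ by ±2πi. -/
lemma norm_sq_resolventKernel {l : ℂ} (hl : l.im ≠ 0) :
    ‖resolventKernel l‖ ^ 2 = Real.pi / |l.im| := by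
  obtain ⟨s, hs, hsl⟩ := exists_sign hl
  have hs' : -s = 1 ∨ -s = -1 := by rcases hs with rfl | rfl <;> simp
  have hl' : (conj l).im ≠ 0 := by simpa using hl
  have h := mul_pairing_resolventKernel hl hl' (traceOne_resolventKernel hs hsl)
    (traceOne_resolventKernel (l := conj l) hs' (by simpa using hsl))
  rw [← star_resolventKernel hl, ← inner_eq_pairing, inner_self_eq_norm_sq_to_K,
    Complex.sub_conj] at h
  have h2 : l.im * ‖resolventKernel l‖ ^ 2 = s * Real.pi := by
    have h3 := congrArg Complex.im h
    simp [← Complex.ofReal_pow] at h3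
    linarith
  have h4 : |l.im| = s * l.im := by
    rcases hs with rfl | rfl
    · rw [abs_of_pos (by linarith), one_mul]
    · rw [abs_of_neg (by linarith), neg_one_mul]
  have h5 : s * s = 1 := by rcases hs with rfl | rfl <;> norm_num
  rw [h4, eq_div_iff hsl.ne']
  linear_combination s * h2 + Real.pi * h5

lemma tendsto_norm_resolventKernel {s : ℝ} (hs : s = 1 ∨ s = -1) :
    Tendsto (fun y : ℝ => ‖resolventKernel ((s * y : ℝ) * I)‖) atTop (𝓝 0) := by
  have h : Tendsto (fun y : ℝ => √(Real.pi / y)) atTop (𝓝 0) := by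
    simpa using (tendsto_const_nhds.div_atTop tendsto_id : Tendsto (fun y : ℝ => Real.pi / y)
      atTop (𝓝 0)).sqrt
  refine h.congr' ?_
  filter_upwards [eventually_gt_atTop 0] with y hy
  have hs0 : s ≠ 0 := by rcases hs with rfl | rfl <;> norm_num
  have him : (((s * y : ℝ) : ℂ) * I).im = s * y := by simp
  have h1 : (((s * y : ℝ) : ℂ) * I).im ≠ 0 := by
    rw [him]; positivity
  have h2 : |s| = 1 := by rcases hs with rfl | rfl <;> simp
  rw [← Real.sqrt_sq (norm_nonneg (resolventKernel _)), norm_sq_resolventKernel h1, him, abs_mul,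
    h2, one_mul, abs_of_pos hy]

lemma tendsto_pairing_resolventKernel {s : ℝ} (hs : s = 1 ∨ s = -1) (h : L2) :
    Tendsto (fun y : ℝ => pairing h (resolventKernel ((s * y : ℝ) * I))) atTop (𝓝 0) := by
  refine squeeze_zero_norm (fun y => norm_pairing_le h _) ?_
  simpa using (tendsto_norm_resolventKernel hs).const_mul ‖h‖

lemma continuousAt_resolventKernel {l : ℂ} (hl : l.im ≠ 0) : ContinuousAt resolventKernel l := by
  have h1 : ∀ᶠ m in 𝓝 l, |l.im| / 2 < |m.im| :=
    (Complex.continuous_im.abs.tendsto l).eventually_const_lt (half_lt_self (abs_pos.2 hl))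
  rw [ContinuousAt, tendsto_iff_norm_sub_tendsto_zero]
  have h2 : Tendsto (fun m : ℂ => ‖m - l‖ * (‖divSub l‖ * √(Real.pi / (|l.im| / 2)))) (𝓝 l)
      (𝓝 0) := by
    have : Tendsto (fun m : ℂ => ‖m - l‖) (𝓝 l) (𝓝 0) := by
      have h := (continuous_id.sub (continuous_const (y := l))).norm.tendsto l
      simpa using h
    simpa using this.mul_const _
  refine squeeze_zero' (Eventually.of_forall fun _ => norm_nonneg _) ?_ h2
  filter_upwards [h1] with m hm
  have hpos : 0 < |l.im| / 2 := half_pos (abs_pos.2 hl)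
  have hm0 : m.im ≠ 0 := abs_pos.1 (hpos.trans hm)
  rw [resolventKernel_sub hm0 hl, divSub_resolventKernel_comm hm0 hl, norm_smul]
  refine mul_le_mul_of_nonneg_left ?_ (norm_nonneg _)
  refine ((divSub l).le_opNorm _).trans (mul_le_mul_of_nonneg_left ?_ (norm_nonneg _))
  refine Real.le_sqrt_of_sq_le ?_
  rw [norm_sq_resolventKernel hm0]
  gcongr

lemma hasDerivAt_resolventKernel {l : ℂ} (hl : l.im ≠ 0) :
    HasDerivAt resolventKernel (divSub l (resolventKernel l)) l := by
  rw [hasDerivAt_iff_tendsto_slope]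
  have h := (((divSub l).continuous.tendsto _).comp (continuousAt_resolventKernel hl)).mono_left
    (nhdsWithin_le_nhds (s := {l}ᶜ))
  refine h.congr' ?_
  have h1 : ∀ᶠ m in 𝓝 l, m.im ≠ 0 := Complex.continuous_im.continuousAt.eventually_ne hl
  filter_upwards [nhdsWithin_le_nhds h1, self_mem_nhdsWithin] with m hm hne
  rw [slope_def_module, resolventKernel_sub hm hl, smul_smul, inv_mul_cancel₀, one_smul,
    Function.comp_apply, divSub_resolventKernel_comm hl hm]
  exact sub_ne_zero.2 hne

lemma differentiableAt_pairing_resolventKernel (h : L2) {l : ℂ} (hl : l.im ≠ 0) :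
    DifferentiableAt ℂ (fun m => pairing h (resolventKernel m)) l :=
  ((pairing h).hasFDerivAt.comp_hasDerivAt l (hasDerivAt_resolventKernel hl)).differentiableAt

/-! ### Totality of the Cauchy kernels via Poisson integrals. -/

/-- The normalised Poisson kernel at height one. -/
noncomputable def poissonKernel (x : ℝ) : ℝ := Real.pi⁻¹ * (1 + x ^ 2)⁻¹

lemma poissonKernel_nonneg (x : ℝ) : 0 ≤ poissonKernel x := by
  unfold poissonKernel; positivity

lemma poissonKernel_le (x : ℝ) : poissonKernel x ≤ Real.pi⁻¹ := by
  unfold poissonKernel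
  refine mul_le_of_le_one_right (by positivity) (inv_le_one_of_one_le₀ ?_)
  nlinarith [sq_nonneg x]

lemma continuous_poissonKernel : Continuous poissonKernel := by
  unfold poissonKernel
  exact continuous_const.mul ((by fun_prop : Continuous fun x : ℝ => 1 + x ^ 2).inv₀
    fun x => by positivity)

lemma integrable_poissonKernel : Integrable poissonKernel :=
  integrable_inv_one_add_sq.const_mul _

lemma integral_poissonKernel : ∫ x, poissonKernel x = 1 := by
  unfold poissonKernel
  rw [integral_const_mul, integral_univ_inv_one_add_sq, inv_mul_cancel₀ Real.pi_ne_zero]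

lemma tendsto_mul_poissonKernel :
    Tendsto (fun x : ℝ => ‖x‖ ^ Module.finrank ℝ ℝ * poissonKernel x)
      (Bornology.cobounded ℝ) (𝓝 0) := by
  have h : Tendsto (fun x : ℝ => ‖x‖⁻¹) (Bornology.cobounded ℝ) (𝓝 0) :=
    tendsto_inv_atTop_zero.comp tendsto_norm_cobounded_atTop
  have h' := h.const_mul Real.pi⁻¹
  rw [mul_zero] at h'
  refine squeeze_zero (fun x => by have := poissonKernel_nonneg x; positivity) (fun x => ?_) h'
  rw [Module.finrank_self, pow_one, poissonKernel, mul_left_comm]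
  refine mul_le_mul_of_nonneg_left ?_ (by positivity)
  rcases eq_or_ne x 0 with rfl | hx
  · simp
  · have : 0 < ‖x‖ := norm_pos_iff.2 hx
    rw [← div_eq_mul_inv, div_le_iff₀ (by positivity), inv_mul_eq_div, le_div_iff₀ this,
      ← sq, Real.norm_eq_abs, sq_abs]
    linarith

/-- An integrable function whose Poisson integrals vanish at all small heights is zero. -/
lemma ae_eq_zero_of_poisson {w : ℝ → ℂ} (hw : Integrable w)
    (h : ∀ c : ℝ, 1 < c → ∀ t : ℝ, ∫ x, ((c * poissonKernel (c * (x - t)) : ℝ) : ℂ) * w x = 0) :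
    w =ᵐ[volume] 0 := by
  refine ae_eq_zero_of_integral_contDiff_smul_eq_zero hw.locallyIntegrable fun f hf hfc => ?_
  have hfi : Integrable f := hf.continuous.integrable_of_hasCompactSupport hfc
  obtain ⟨C, hC⟩ := hfc.exists_bound_of_continuous hf.continuous
  -- Poisson smoothing of the test function at height 1/c. By Fubini the kernel moves from f onto w,
  -- where it gives 0. Since u c → f pointwise with a uniform bound, dominated convergence yields ∫
  -- f w = 0.
  set u : ℝ → ℝ → ℝ := fun c x => ∫ t, (c * poissonKernel (c * (x - t))) * f t with hu
  have hlim : ∀ x, Tendsto (fun c => u c x) atTop (𝓝 (f x)) := by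
    intro x
    have h1 := tendsto_integral_comp_smul_smul_of_integrable' poissonKernel_nonneg
      integral_poissonKernel tendsto_mul_poissonKernel hfi (hf.continuous.continuousAt (x := x))
    simpa [Module.finrank_self, hu] using h1
  have hint1 : ∀ c : ℝ, 1 < c → ∀ x, Integrable (fun t => c * poissonKernel (c * (x - t))) := by
    intro c hc x
    exact (((integrable_poissonKernel.comp_mul_left' (by positivity : c ≠ 0)).comp_sub_left x
      ).const_mul c)
  have hone : ∀ c : ℝ, 1 < c → ∀ x, ∫ t, c * poissonKernel (c * (x - t)) = 1 := by
    intro c hc x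
    rw [integral_const_mul, integral_sub_left_eq_self (fun t => poissonKernel (c * t)) volume x,
      Measure.integral_comp_mul_left, integral_poissonKernel, abs_of_pos (by positivity)]
    simp only [smul_eq_mul, mul_one]
    field_simp
  have hbound : ∀ c : ℝ, 1 < c → ∀ x, ‖u c x‖ ≤ C := by
    intro c hc x
    calc ‖u c x‖ ≤ ∫ t, (c * poissonKernel (c * (x - t))) * C := by
          refine norm_integral_le_of_norm_le ((hint1 c hc x).mul_const C) (ae_of_all _ fun t => ?_)
          have h0 : 0 ≤ c * poissonKernel (c * (x - t)) :=
            mul_nonneg (by positivity) (poissonKernel_nonneg _)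
          rw [norm_mul, Real.norm_of_nonneg h0]
          exact mul_le_mul_of_nonneg_left (hC t) h0
      _ = C := by rw [integral_mul_const, hone c hc x, one_mul]
  have hF : ∀ c : ℝ, 1 < c →
      Integrable (Function.uncurry fun x t =>
        (((c * poissonKernel (c * (x - t)) * f t : ℝ)) : ℂ) * w x) (volume.prod volume) := by
    intro c hc
    have h1 : Integrable (fun p : ℝ × ℝ => w p.1 * (f p.2 : ℂ)) (volume.prod volume) :=
      hw.mul_prod hfi.ofReal
    refine (h1.bdd_mul (f := fun p : ℝ × ℝ => ((c * poissonKernel (c * (p.1 - p.2)) : ℝ) : ℂ))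
      (c := c * Real.pi⁻¹) ?_ (ae_of_all _ fun p => ?_)).congr (ae_of_all _ fun p => ?_)
    · have := continuous_poissonKernel
      exact Continuous.aestronglyMeasurable (by fun_prop)
    · have h0 : 0 ≤ c * poissonKernel (c * (p.1 - p.2)) :=
        mul_nonneg (by positivity) (poissonKernel_nonneg _)
      rw [Complex.norm_real, Real.norm_of_nonneg h0]
      exact mul_le_mul_of_nonneg_left (poissonKernel_le _) (by positivity)
    · simp only [Function.uncurry]
      push_cast
      ring
  have hzero : ∀ c : ℝ, 1 < c → ∫ x, (u c x : ℂ) * w x = 0 := by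
    intro c hc
    have h1 : ∀ x, (u c x : ℂ) * w x
        = ∫ t, (((c * poissonKernel (c * (x - t)) * f t : ℝ)) : ℂ) * w x := by
      intro x
      rw [integral_mul_const, integral_complex_ofReal]
    simp_rw [h1]
    rw [integral_integral_swap (hF c hc)]
    refine integral_eq_zero_of_ae (ae_of_all _ fun t => ?_)
    have h2 := h c hc t
    calc ∫ x, (((c * poissonKernel (c * (x - t)) * f t : ℝ)) : ℂ) * w x
        = ∫ x, (f t : ℂ) * ((((c * poissonKernel (c * (x - t)) : ℝ)) : ℂ) * w x) := by
          congr 1; ext x; push_cast; ring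
      _ = 0 := by rw [integral_const_mul, h2, mul_zero]
  have hlim2 : Tendsto (fun c : ℝ => ∫ x, (u c x : ℂ) * w x) atTop (𝓝 (∫ x, (f x : ℂ) * w x)) := by
    refine tendsto_integral_filter_of_dominated_convergence (fun x => C * ‖w x‖) ?_ ?_
      (hw.norm.const_mul C) (ae_of_all _ fun x => ?_)
    · filter_upwards [eventually_gt_atTop 1] with c hc
      have h1 := (hF c hc).aestronglyMeasurable.integral_prod_right'
      refine h1.congr (ae_of_all _ fun x => ?_)
      simp only [Function.uncurry]
      rw [integral_mul_const, integral_complex_ofReal]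
    · filter_upwards [eventually_gt_atTop 1] with c hc
      refine ae_of_all _ fun x => ?_
      rw [norm_mul, Complex.norm_real]
      exact mul_le_mul_of_nonneg_right (hbound c hc x) (norm_nonneg _)
    · exact ((Complex.continuous_ofReal.tendsto _).comp (hlim x)).mul_const _
  have hlim3 : Tendsto (fun c : ℝ => ∫ x, (u c x : ℂ) * w x) atTop (𝓝 0) := by
    refine tendsto_const_nhds.congr' ?_
    filter_upwards [eventually_gt_atTop 1] with c hc
    exact (hzero c hc).symm
  simpa using tendsto_nhds_unique hlim2 hlim3

/-- The kernels `1 / (x - l)`, for `l` non-real, are total in `L²(ℝ)`. -/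
lemma eq_zero_of_pairing_resolventKernel {g : L2}
    (h : ∀ l : ℂ, l.im ≠ 0 → pairing g (resolventKernel l) = 0) : g = 0 := by
  have hI : I.im ≠ 0 := by simp
  -- Dividing by x - i makes g integrable, as the Poisson criterion requires. The division by i - l
  -- excludes the point l = i, which is why only heights 1/c < 1 are used below.
  have hpair : ∀ l : ℂ, l.im ≠ 0 → l ≠ I →
      pairing (divSub I g) (resolventKernel l) = 0 := by
    intro l hl hne
    have h1 := mul_pairing_divSub_resolventKernel g hI hl
    rw [h I hI, h l hl, sub_zero, pairing_divSub hI] at h1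
    exact (mul_eq_zero.1 h1).resolve_left (sub_ne_zero.2 hne.symm)
  have hw : divSub I g =ᵐ[volume] (0 : ℝ → ℂ) := by
    refine ae_eq_zero_of_poisson (integral_divSub hI g).1 fun c hc t => ?_
    have hc0 : 0 < c := by positivity
    set l : ℂ := (t : ℂ) + (c⁻¹ : ℝ) * I with hl
    have him : l.im = c⁻¹ := by simp [hl]
    have hl0 : l.im ≠ 0 := by rw [him]; positivity
    have hl0' : (conj l).im ≠ 0 := by simpa using hl0
    have hlt : c⁻¹ < 1 := inv_lt_one_of_one_lt₀ hc
    have hne : l ≠ I := by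
      intro h'
      rw [h', Complex.I_im] at him
      linarith
    have hne' : conj l ≠ I := by
      intro h'
      have := congrArg Complex.im h'
      simp only [Complex.conj_im, Complex.I_im, him] at this
      have : 0 < c⁻¹ := by positivity
      linarith
    have h1 : pairing (divSub I g) (resolventKernel l - resolventKernel (conj l)) = 0 := by
      rw [map_sub, hpair l hl0 hne, hpair _ hl0' hne', sub_zero]
    rw [pairing_apply] at h1
    have h2 : ∫ x, ((c * poissonKernel (c * (x - t)) : ℝ) : ℂ) * divSub I g x
        = ∫ x, (2 * Real.pi * I : ℂ)⁻¹ *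
          (divSub I g x * (resolventKernel l - resolventKernel (conj l) : L2) x) := by
      refine integral_congr_ae ?_
      filter_upwards [Lp.coeFn_sub (resolventKernel l) (resolventKernel (conj l)),
        coeFn_resolventKernel hl0, coeFn_resolventKernel hl0'] with x hx1 hx2 hx3
      rw [hx1, Pi.sub_apply, hx2, hx3]
      have hd1 := sub_ne_zero_of_im hl0 x
      have hd2 := sub_ne_zero_of_im hl0' x
      have hconj : conj l = (t : ℂ) - (c⁻¹ : ℝ) * I := by simp [hl, sub_eq_add_neg]
      have hprod : ((x : ℂ) - l) * (x - conj l) = (((x - t) ^ 2 + (c⁻¹) ^ 2 : ℝ) : ℂ) := by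
        rw [hconj, hl]
        push_cast
        linear_combination -((c : ℂ)⁻¹) ^ 2 * I_sq
      have hdiff : ((x : ℂ) - l)⁻¹ - (x - conj l)⁻¹
          = (l - conj l) / (((x - t) ^ 2 + (c⁻¹) ^ 2 : ℝ) : ℂ) := by
        rw [← hprod]
        field_simp
        ring
      have hreal : c * poissonKernel (c * (x - t))
          = Real.pi⁻¹ * c⁻¹ / ((x - t) ^ 2 + (c⁻¹) ^ 2) := by
        unfold poissonKernel
        field_simp
        ring
      have hpi : (Real.pi : ℂ) ≠ 0 := by exact_mod_cast Real.pi_ne_zero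
      rw [hdiff, Complex.sub_conj, him, hreal]
      push_cast
      field_simp
    rw [h2, integral_const_mul, h1, mul_zero]
  refine Lp.eq_zero_iff_ae_eq_zero.2 ?_
  filter_upwards [hw, coeFn_divSub hI g] with x h1 h2
  rw [h1] at h2
  have := inv_ne_zero (sub_ne_zero_of_im hI x)
  simpa [this] using h2.symm

/-! ### Density of the minimal domain and the action of the maximal operator. -/

lemma resolventKernel_sub_mem_minDomain {s : ℝ} (hs : s = 1 ∨ s = -1) {l m : ℂ}
    (hl : 0 < s * l.im) (hm : 0 < s * m.im) :
    resolventKernel l - resolventKernel m ∈ minDomain := by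
  have hl' : l.im ≠ 0 := right_ne_zero_of_mul hl.ne'
  have hm' : m.im ≠ 0 := right_ne_zero_of_mul hm.ne'
  have h1 := traceTwo_sub (traceTwo_resolventKernel hl') (traceTwo_resolventKernel hm')
  have h2 := traceOne_sub (traceOne_resolventKernel hs hl) (traceOne_resolventKernel hs hm)
  rw [sub_self] at h1 h2
  exact ⟨by simpa [TraceTwo] using h1, h2⟩

lemma star_zero_L2 : star (0 : L2) = 0 := by
  refine Lp.ext ?_
  filter_upwards [Lp.coeFn_star (0 : L2), Lp.coeFn_zero ℂ 2 (volume : Measure ℝ)] with x h1 h2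
  rw [h1, Pi.star_apply, h2]
  simp

/-- A vector orthogonal to differences of kernels with poles on the same side pairs to a constant
with all kernels of that half-plane. The constant is 0 because the kernels decay, so totality
applies. -/
lemma dense_minDomain : Dense (minDomain : Set L2) := by
  rw [Submodule.dense_iff_topologicalClosure_eq_top, Submodule.topologicalClosure_eq_top_iff,
    Submodule.eq_bot_iff]
  intro g hg
  have hz : star g = 0 := by
    refine eq_zero_of_pairing_resolventKernel fun l hl => ?_
    obtain ⟨s, hs, hsl⟩ := exists_sign hl
    have hss : s * s = 1 := by rcases hs with rfl | rfl <;> norm_num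
    refine tendsto_nhds_unique (tendsto_const_nhds.congr' ?_)
      (tendsto_pairing_resolventKernel hs (star g))
    filter_upwards [eventually_gt_atTop 0] with y hy
    have hm : 0 < s * (((s * y : ℝ) : ℂ) * I).im := by
      simp only [mul_im, ofReal_re, I_im, mul_one, ofReal_im, I_re, mul_zero, add_zero,
        ← mul_assoc, hss, one_mul]
      exact hy
    have h1 := (Submodule.mem_orthogonal' _ _).1 hg _ (resolventKernel_sub_mem_minDomain hs hsl hm)
    rw [inner_eq_pairing, map_sub, sub_eq_zero] at h1
    exact h1
  rw [← star_star g, hz, star_zero_L2]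

/-- The two integrands differ by conj c · f, whose principal value integral vanishes by the
definition of the minimal domain. -/
lemma inner_mulX {u : L2} {c : ℂ} (hc : TraceTwo u c) (f : minDomain) :
    inner ℂ (MemLp.toLp _ hc) (f : L2) = inner ℂ u (mulX f) := by
  rw [← sub_eq_zero, ← neg_eq_zero, neg_sub, L2.inner_def, L2.inner_def,
    ← integral_sub (L2.integrable_inner _ _) (L2.integrable_inner _ _)]
  have hint := (L2.integrable_inner (𝕜 := ℂ) u (mulX f)).sub
    (L2.integrable_inner (𝕜 := ℂ) (MemLp.toLp _ hc) (f : L2))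
  have h1 := intervalIntegral_tendsto_integral hint tendsto_neg_atTop_atBot tendsto_id
  refine tendsto_nhds_unique h1 ?_
  have h2 := f.2.2.const_mul (conj c)
  rw [mul_zero] at h2
  refine h2.congr fun R => ?_
  rw [id, ← intervalIntegral.integral_const_mul]
  refine intervalIntegral.integral_congr_ae ?_
  have hX : mulX f =ᵐ[volume] fun x : ℝ => (x : ℂ) * (f : L2) x := f.2.1.coeFn_toLp
  filter_upwards [hX, hc.coeFn_toLp] with x hx1 hx2 _
  simp only [Pi.sub_apply, hx1, hx2, RCLike.inner_apply, map_sub, map_mul, Complex.conj_ofReal]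
  ring

/-- Only this half of the description of the adjoint is needed, since the boundary condition already
supplies the trace Γ₂. -/
lemma maxOp_apply_of_traceTwo (φ ψ : L2) {u : L2} {c : ℂ} (hc : TraceTwo u c) :
    ∃ h : u ∈ (maxOp φ ψ).domain,
      maxOp φ ψ ⟨u, h⟩ = MemLp.toLp _ hc + inner ℂ φ u • ψ := by
  have key : ∀ f : (minOp ψ φ).domain,
      inner ℂ (MemLp.toLp _ hc + inner ℂ φ u • ψ) (f : L2) = inner ℂ u (minOp ψ φ f) := by
    intro f
    have h1 : minOp ψ φ f = mulX f + inner ℂ ψ (f : L2) • φ := rfl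
    rw [h1, inner_add_left, inner_add_right, inner_mulX hc f, inner_smul_left, inner_smul_right,
      inner_conj_symm]
    ring
  exact ⟨LinearPMap.mem_adjoint_domain_of_exists _ ⟨_, key⟩,
    LinearPMap.adjoint_apply_eq dense_minDomain _ key⟩

/-- Write (x - l)u = (xu - c) - lu + c and divide: every function with trace Γ₂ = c is thereby
parametrised by an L² function and c. -/
lemma eq_divSub_add {l : ℂ} (hl : l.im ≠ 0) {u : L2} {c : ℂ} (hc : TraceTwo u c) :
    u = divSub l (MemLp.toLp _ hc - l • u) + c • resolventKernel l := by
  refine Lp.ext ?_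
  filter_upwards [Lp.coeFn_add (divSub l (MemLp.toLp _ hc - l • u)) (c • resolventKernel l),
    coeFn_divSub hl (MemLp.toLp _ hc - l • u), Lp.coeFn_sub (MemLp.toLp _ hc) (l • u),
    Lp.coeFn_smul l u, Lp.coeFn_smul c (resolventKernel l), coeFn_resolventKernel hl,
    hc.coeFn_toLp] with x h1 h2 h3 h4 h5 h6 h7
  have := sub_ne_zero_of_im hl x
  rw [h1, Pi.add_apply, h2, h3, Pi.sub_apply, h4, h5, h7, Pi.smul_apply, Pi.smul_apply, h6,
    smul_eq_mul, smul_eq_mul]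
  field_simp
  ring

lemma traceTwo_divSub_add {l : ℂ} (hl : l.im ≠ 0) (g : L2) (c : ℂ) :
    TraceTwo (divSub l g + c • resolventKernel l) c := by
  simpa using (traceTwo_divSub hl g).add ((traceTwo_resolventKernel hl).smul c)

lemma traceOne_divSub_add {l a : ℂ} (hl : l.im ≠ 0) (ha : TraceOne (resolventKernel l) a)
    (g : L2) (c : ℂ) :
    TraceOne (divSub l g + c • resolventKernel l) (pairing g (resolventKernel l) + c * a) :=
  (traceOne_divSub hl g).add (ha.smul c)

lemma toLp_sub_smul_divSub_add {l : ℂ} (hl : l.im ≠ 0) (g : L2) (c : ℂ) :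
    MemLp.toLp _ (traceTwo_divSub_add hl g c) - l • (divSub l g + c • resolventKernel l) = g := by
  have hc := traceTwo_divSub_add hl g c
  refine Lp.ext ?_
  filter_upwards [Lp.coeFn_add (divSub l g) (c • resolventKernel l), coeFn_divSub hl g,
    Lp.coeFn_sub (MemLp.toLp _ hc) (l • (divSub l g + c • resolventKernel l)),
    Lp.coeFn_smul l (divSub l g + c • resolventKernel l),
    Lp.coeFn_smul c (resolventKernel l), coeFn_resolventKernel hl,
    hc.coeFn_toLp] with x h1 h2 h3 h4 h5 h6 h7
  have := sub_ne_zero_of_im hl x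
  rw [h3, Pi.sub_apply, h4, h7, Pi.smul_apply, h1, Pi.add_apply, h2, h5, Pi.smul_apply, h6,
    smul_eq_mul, smul_eq_mul]
  field_simp
  ring

lemma maxOp_divSub_add (φ ψ : L2) {l : ℂ} (hl : l.im ≠ 0) {u g : L2} {c : ℂ}
    (hu : u = divSub l g + c • resolventKernel l) :
    ∃ h : u ∈ (maxOp φ ψ).domain, maxOp φ ψ ⟨u, h⟩ - l • u = g + inner ℂ φ u • ψ := by
  subst hu
  obtain ⟨h, h'⟩ := maxOp_apply_of_traceTwo φ ψ (traceTwo_divSub_add hl g c)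
  refine ⟨h, ?_⟩
  rw [h', add_sub_right_comm, toLp_sub_smul_divSub_add hl]

/-! ### Resolvent and solution operator by a two-by-two linear system. -/

/-- The determinant of the linear system for the resolvent of `A_B` at `l`, where `a` is the
principal value of `∫ dx / (x - l)`. -/
noncomputable def resolventDet (φ ψ : L2) (B a l : ℂ) : ℂ :=
  (1 + pairing (star φ) (divSub l ψ)) * (a - B)
    - pairing (star φ) (resolventKernel l) * pairing ψ (resolventKernel l)

lemma mem_resolventSet_of_resolventDet_ne_zero {φ ψ : L2} {B a l : ℂ} (hl : l.im ≠ 0)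
    (ha : TraceOne (resolventKernel l) a) (hD : resolventDet φ ψ B a l ≠ 0) :
    l ∈ resolventSet (extOp φ ψ B) := by
  set r := pairing (star φ) (divSub l ψ) with hr
  set q := pairing (star φ) (resolventKernel l) with hq
  set p := pairing ψ (resolventKernel l) with hp
  set D := resolventDet φ ψ B a l with hDdef
  have hDeq : D = (1 + r) * (a - B) - q * p := rfl
  set α : L2 →L[ℂ] ℂ := (pairing (star φ)).comp (divSub l) with hα
  set β : L2 →L[ℂ] ℂ := pairing (resolventKernel l) with hβ
  set dL : L2 →L[ℂ] ℂ := D⁻¹ • ((a - B) • α - q • β) with hdL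
  set cL : L2 →L[ℂ] ℂ := D⁻¹ • (p • α - (1 + r) • β) with hcL
  have hd_apply : ∀ f, D * dL f = (a - B) * α f - q * β f := by
    intro f
    simp only [hdL, smul_apply, sub_apply, smul_eq_mul]
    rw [mul_inv_cancel_left₀ hD]
  have hc_apply : ∀ f, D * cL f = p * α f - (1 + r) * β f := by
    intro f
    simp only [hcL, smul_apply, sub_apply, smul_eq_mul]
    rw [mul_inv_cancel_left₀ hD]
  have hsys1 : ∀ f, dL f * (1 + r) - cL f * q = α f := by
    intro f
    apply mul_left_cancel₀ hD
    linear_combination (1 + r) * hd_apply f - q * hc_apply f - α f * hDeq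
  have hsys2 : ∀ f, cL f * (a - B) - dL f * p = -β f := by
    intro f
    apply mul_left_cancel₀ hD
    linear_combination (a - B) * hc_apply f - p * hd_apply f + β f * hDeq
  set R : L2 →L[ℂ] L2 :=
    divSub l + cL.smulRight (resolventKernel l) - dL.smulRight (divSub l ψ) with hR
  have hRf : ∀ f, R f = divSub l (f - dL f • ψ) + cL f • resolventKernel l := by
    intro f
    simp only [hR, sub_apply, add_apply,
      ContinuousLinearMap.smulRight_apply, map_sub, map_smul]
    abel
  refine ⟨R, fun f => ?_, fun u => ?_⟩
  · obtain ⟨h, h'⟩ := maxOp_divSub_add φ ψ hl (hRf f)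
    have hinner : inner ℂ φ (R f) = dL f := by
      rw [inner_eq_pairing, hRf]
      simp only [map_add, map_sub, map_smul, smul_eq_mul, ← hr, ← hq]
      have h2 : pairing (star φ) (divSub l f) = α f := rfl
      rw [h2]
      linear_combination -hsys1 f
    have hbc : R f ∈ boundaryCondition B := by
      refine ⟨pairing (f - dL f • ψ) (resolventKernel l) + cL f * a, cL f, ?_, ?_, ?_⟩
      · rw [hRf]; exact traceOne_divSub_add hl ha _ _
      · rw [hRf]; exact traceTwo_divSub_add hl _ _
      · rw [pairing_comm, map_sub, map_smul, ← hβ, smul_eq_mul]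
        have h2 : β ψ = p := pairing_comm _ _
        rw [h2]
        linear_combination hsys2 f
    refine ⟨⟨hbc, h⟩, ?_⟩
    have h3 : extOp φ ψ B ⟨R f, ⟨hbc, h⟩⟩ = maxOp φ ψ ⟨R f, h⟩ := LinearPMap.domRestrict_apply rfl
    rw [h3, h', hinner, sub_add_cancel]
  · obtain ⟨u, ⟨a', c, ha', hc, hac⟩, hdom⟩ := u
    obtain ⟨h, h'⟩ := maxOp_apply_of_traceTwo φ ψ hc
    have h3 : extOp φ ψ B ⟨u, ⟨⟨a', c, ha', hc, hac⟩, hdom⟩⟩ = maxOp φ ψ ⟨u, h⟩ :=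
      LinearPMap.domRestrict_apply rfl
    simp only [h3, h']
    set d := inner ℂ φ u with hd
    set f := MemLp.toLp _ hc + d • ψ - l • u with hf
    have hu : u = divSub l (f - d • ψ) + c • resolventKernel l := by
      have h4 : f - d • ψ = MemLp.toLp _ hc - l • u := by rw [hf]; abel
      rw [h4]
      exact eq_divSub_add hl hc
    have e1 : d * (1 + r) - c * q = α f := by
      have h5 : d = α f - d * r + c * q := by
        conv_lhs => rw [hd, inner_eq_pairing, hu]
        simp only [map_add, map_sub, map_smul, smul_eq_mul, ← hr, ← hq]
        rfl
      linear_combination h5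
    have e2 : c * (a - B) - d * p = -β f := by
      have h6 := traceOne_divSub_add hl ha (f - d • ψ) c
      rw [← hu] at h6
      have h7 := ha'.unique h6
      rw [pairing_comm, map_sub, map_smul, ← hβ, smul_eq_mul,
        (pairing_comm _ _ : β ψ = p)] at h7
      linear_combination hac - h7
    have e3 : dL f = d := by
      apply mul_left_cancel₀ hD
      linear_combination hd_apply f - (a - B) * e1 - q * e2 - d * hDeq
    have e4 : cL f = c := by
      apply mul_left_cancel₀ hD
      linear_combination hc_apply f - p * e1 - (1 + r) * e2 - c * hDeq
    rw [hRf, e3, e4, ← hu]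

/-- The solution of `(Ã* - l) u = 0`, `(Γ₁ - B Γ₂) u = 1`, when the determinant is non-zero. -/
noncomputable def kernelSolution (φ ψ : L2) (B a l : ℂ) : L2 :=
  (resolventDet φ ψ B a l)⁻¹ • ((1 + pairing (star φ) (divSub l ψ)) • resolventKernel l
    - pairing (star φ) (resolventKernel l) • divSub l ψ)

lemma isSolution_kernelSolution {φ ψ : L2} {B a l : ℂ} (hl : l.im ≠ 0)
    (ha : TraceOne (resolventKernel l) a) (hD : resolventDet φ ψ B a l ≠ 0) :
    IsSolution φ ψ B l 1 (kernelSolution φ ψ B a l) := by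
  set r := pairing (star φ) (divSub l ψ) with hr
  set q := pairing (star φ) (resolventKernel l) with hq
  set p := pairing ψ (resolventKernel l) with hp
  set D := resolventDet φ ψ B a l with hDdef
  have hDeq : D = (1 + r) * (a - B) - q * p := rfl
  have hu : kernelSolution φ ψ B a l
      = divSub l ((-(D⁻¹ * q)) • ψ) + (D⁻¹ * (1 + r)) • resolventKernel l := by
    rw [kernelSolution, ← hr, ← hq, ← hDdef, map_smul]
    module
  have hinner : inner ℂ φ (kernelSolution φ ψ B a l) = D⁻¹ * q := by
    rw [inner_eq_pairing, kernelSolution, ← hr, ← hq, ← hDdef]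
    simp only [map_sub, map_smul, smul_eq_mul, ← hr, ← hq]
    ring
  refine ⟨?_, pairing ((-(D⁻¹ * q)) • ψ) (resolventKernel l) + D⁻¹ * (1 + r) * a,
    D⁻¹ * (1 + r), ?_, ?_, ?_⟩
  · obtain ⟨h, h'⟩ := maxOp_divSub_add φ ψ hl hu
    refine ⟨h, ?_⟩
    rw [h', hinner, ← add_smul, neg_add_cancel, zero_smul]
  · rw [hu]; exact traceOne_divSub_add hl ha _ _
  · rw [hu]; exact traceTwo_divSub_add hl _ _
  · rw [pairing_comm, map_smul, smul_eq_mul, pairing_comm, ← hp]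
    linear_combination inv_mul_cancel₀ hD - D⁻¹ * hDeq

/-- The difference u - v satisfies the homogeneous boundary condition, and applying A_B - δ to it
gives mu - δv - δ(u - v) = (m - δ)u. -/
lemma resolvent_apply_of_isSolution {φ ψ : L2} {B δ m : ℂ} {R : L2 →L[ℂ] L2}
    (hR : IsResolventAt (extOp φ ψ B) δ R) {u v : L2} (hu : IsSolution φ ψ B m 1 u)
    (hv : IsSolution φ ψ B δ 1 v) : (m - δ) • R u = u - v := by
  obtain ⟨⟨hud, hu0⟩, a, c, ha, hc, hac⟩ := hu
  obtain ⟨⟨hvd, hv0⟩, a', c', ha', hc', hac'⟩ := hv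
  have hdom : u - v ∈ (maxOp φ ψ).domain := Submodule.sub_mem _ hud hvd
  have hbc : u - v ∈ boundaryCondition B :=
    ⟨a - a', c - c', traceOne_sub ha ha', traceTwo_sub hc hc', by linear_combination hac - hac'⟩
  have h3 : extOp φ ψ B ⟨u - v, ⟨hbc, hdom⟩⟩ = maxOp φ ψ ⟨u, hud⟩ - maxOp φ ψ ⟨v, hvd⟩ := by
    rw [← LinearPMap.map_sub]
    exact LinearPMap.domRestrict_apply rfl
  have h4 := hR.2 ⟨u - v, ⟨hbc, hdom⟩⟩
  rw [h3, sub_eq_zero.1 hu0, sub_eq_zero.1 hv0] at h4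
  change R _ = u - v at h4
  rw [← h4, ← map_smul]
  congr 1
  module

/-- The witness is v + (m - δ)(A_B - m)⁻¹v: the correction does not change the boundary value. This
covers every m in the resolvent set, including points where the explicit formula is not available.
-/
lemma exists_isSolution {φ ψ : L2} {B δ m : ℂ} (hm : m ∈ resolventSet (extOp φ ψ B)) {v : L2}
    (hv : IsSolution φ ψ B δ 1 v) : ∃ u, IsSolution φ ψ B m 1 u := by
  obtain ⟨R, hR⟩ := hm
  obtain ⟨⟨hvd, hv0⟩, a, c, ha, hc, hac⟩ := hv
  obtain ⟨⟨⟨a', c', ha', hc', hac'⟩, hd⟩, hR1⟩ := hR.1 v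
  refine ⟨v + (m - δ) • R v, ⟨Submodule.add_mem _ hvd (Submodule.smul_mem _ _ hd), ?_⟩,
    _, _, ha.add (ha'.smul (m - δ)), hc.add (hc'.smul (m - δ)), ?_⟩
  · have h3 : extOp φ ψ B ⟨R v, ⟨⟨a', c', ha', hc', hac'⟩, hd⟩⟩ = maxOp φ ψ ⟨R v, hd⟩ :=
      LinearPMap.domRestrict_apply rfl
    rw [h3] at hR1
    have h4 : maxOp φ ψ ⟨v + (m - δ) • R v,
        Submodule.add_mem _ hvd (Submodule.smul_mem _ _ hd)⟩
        = maxOp φ ψ ⟨v, hvd⟩ + (m - δ) • maxOp φ ψ ⟨R v, hd⟩ := by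
      rw [← LinearPMap.map_smul, ← LinearPMap.map_add]
      rfl
    rw [h4, sub_eq_zero.1 hv0, sub_eq_iff_eq_add.1 hR1]
    module
  · linear_combination hac + (m - δ) * hac'


/-! ### Cauchy integrals of Hardy functions. -/

lemma integral_mul_resolventKernel {f : ℝ → ℂ} (hf : MemLp f 2 volume) {l : ℂ} (hl : l.im ≠ 0) :
    ∫ x : ℝ, f x * ((x : ℂ) - l)⁻¹ = pairing (hf.toLp f) (resolventKernel l) := by
  rw [pairing_apply]
  refine integral_congr_ae ?_
  filter_upwards [hf.coeFn_toLp, coeFn_resolventKernel hl] with x h1 h2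
  rw [h1, h2]

lemma norm_resolventKernel_le_of_le {l : ℂ} {d : ℝ} (hd : 0 < d) (hl : d ≤ |l.im|) :
    ‖resolventKernel l‖ ≤ √(Real.pi / d) := by
  refine Real.le_sqrt_of_sq_le ?_
  rw [norm_sq_resolventKernel (abs_pos.1 (hd.trans_le hl))]
  gcongr

lemma integral_norm_mul_le {f g : ℝ → ℂ} (hf : MemLp f 2 volume) (hg : MemLp g 2 volume) :
    ∫ x, ‖f x * g x‖ ≤ ‖hf.toLp f‖ * ‖hg.toLp g‖ := by
  have h := eLpNorm_smul_le_mul_eLpNorm (p := 2) (q := 2) (r := 1) hg.1 hf.1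
  change ∫ x, ‖(f * g) x‖ ≤ _
  rw [integral_norm_eq_lintegral_enorm (hf.1.mul hg.1), ← eLpNorm_one_eq_lintegral_enorm,
    Lp.norm_toLp, Lp.norm_toLp, ← ENNReal.toReal_mul]
  exact ENNReal.toReal_mono (ENNReal.mul_ne_top hf.2.ne hg.2.ne) h

/-- If `k` is holomorphic in the upper half-plane and the integrals of `|k|` along horizontal
lines are bounded, then the integrals of `k` along these lines coincide. -/
lemma integral_line_eq {k : ℂ → ℂ} (hk : DifferentiableOn ℂ k {z : ℂ | 0 < z.im})
    {y₁ y₂ M : ℝ} (hy₁ : 0 < y₁) (hy : y₁ ≤ y₂)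
    (hint : ∀ y : ℝ, 0 < y → Integrable fun x : ℝ => k ((x : ℂ) + (y : ℂ) * I))
    (hM : ∀ y : ℝ, 0 < y → ∫ x : ℝ, ‖k ((x : ℂ) + (y : ℂ) * I)‖ ≤ M) :
    ∫ x : ℝ, k ((x : ℂ) + (y₁ : ℂ) * I) = ∫ x : ℝ, k ((x : ℂ) + (y₂ : ℂ) * I) := by
  have hcont : ContinuousOn (fun p : ℝ × ℝ => k ((p.1 : ℂ) + (p.2 : ℂ) * I))
      (Set.univ ×ˢ Set.Ioc y₁ y₂) := by
    refine hk.continuousOn.comp (by fun_prop) ?_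
    rintro ⟨x, y⟩ ⟨-, hy, -⟩
    simpa using hy₁.trans hy
  have hprod : Integrable (fun p : ℝ × ℝ => k ((p.1 : ℂ) + (p.2 : ℂ) * I))
      (volume.prod (volume.restrict (Set.Ioc y₁ y₂))) := by
    have hmeas : AEStronglyMeasurable (fun p : ℝ × ℝ => k ((p.1 : ℂ) + (p.2 : ℂ) * I))
        ((volume : Measure ℝ).prod (volume.restrict (Set.Ioc y₁ y₂))) := by
      have h := hcont.aestronglyMeasurable (μ := (volume : Measure ℝ).prod volume)
        (MeasurableSet.univ.prod measurableSet_Ioc)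
      rwa [← Measure.prod_restrict, Measure.restrict_univ] at h
    refine (integrable_prod_iff' hmeas).2 ⟨?_, ?_⟩
    · filter_upwards [ae_restrict_mem measurableSet_Ioc] with y hy
      exact hint y (hy₁.trans hy.1)
    · refine Integrable.mono' (integrable_const M) hmeas.norm.prod_swap.integral_prod_right' ?_
      filter_upwards [ae_restrict_mem measurableSet_Ioc] with y hy
      rw [Real.norm_of_nonneg (integral_nonneg fun x => norm_nonneg _)]
      exact hM y (hy₁.trans hy.1)
  -- S bounds the integral over the vertical side at abscissa x of a rectangular contour, and is
  -- integrable in x by Fubini.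
  set S : ℝ → ℝ := fun x => ∫ y in y₁..y₂, ‖k ((x : ℂ) + (y : ℂ) * I)‖ with hS
  have hSint : Integrable S := by
    have h := hprod.norm.integral_prod_left
    refine h.congr (ae_of_all _ fun x => ?_)
    simp only [hS, intervalIntegral.integral_of_le hy]
  have hSint' : Integrable fun x => S x + S (-x) := hSint.add hSint.comp_neg
  by_contra hne
  set L := ∫ x : ℝ, k ((x : ℂ) + (y₁ : ℂ) * I) with hL
  set L' := ∫ x : ℝ, k ((x : ℂ) + (y₂ : ℂ) * I) with hL'
  have hlim := ((intervalIntegral_tendsto_integral (hint y₁ hy₁) tendsto_neg_atTop_atBot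
    tendsto_id).sub (intervalIntegral_tendsto_integral (hint y₂ (hy₁.trans_le hy))
      tendsto_neg_atTop_atBot tendsto_id)).norm
  have hpos : 0 < ‖L - L'‖ := norm_pos_iff.2 (sub_ne_zero.2 hne)
  have hbound : ∀ R : ℝ, ‖(∫ x in (-R)..R, k ((x : ℂ) + (y₁ : ℂ) * I))
      - ∫ x in (-R)..R, k ((x : ℂ) + (y₂ : ℂ) * I)‖ ≤ S R + S (-R) := by
    intro R
    have h := integral_boundary_rect_eq_zero_of_differentiableOn k ⟨-R, y₁⟩ ⟨R, y₂⟩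
      (hk.mono (by
        rintro z ⟨-, hz⟩
        rw [Set.mem_preimage, Set.uIcc_of_le hy] at hz
        exact hy₁.trans_le hz.1))
    simp only at h
    have hside : ∀ x : ℝ, ‖I • ∫ y in y₁..y₂, k ((x : ℂ) + (y : ℂ) * I)‖ ≤ S x := by
      intro x
      rw [norm_smul, norm_I, one_mul]
      exact intervalIntegral.norm_integral_le_integral_norm hy
    have h2 : (∫ x in (-R)..R, k ((x : ℂ) + (y₁ : ℂ) * I))
        - ∫ x in (-R)..R, k ((x : ℂ) + (y₂ : ℂ) * I)
        = (I • ∫ y in y₁..y₂, k (((-R : ℝ) : ℂ) + (y : ℂ) * I))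
          - I • ∫ y in y₁..y₂, k ((R : ℂ) + (y : ℂ) * I) := by
      linear_combination h
    rw [h2]
    refine (norm_sub_le _ _).trans ?_
    rw [add_comm (S R)]
    exact add_le_add (hside _) (hside _)
  obtain ⟨R₀, hR₀⟩ := eventually_atTop.1 (hlim.eventually_const_lt (half_lt_self hpos))
  -- If the two line integrals differed, Cauchy's theorem on rectangles would keep the integrable
  -- function S(R) + S(-R) above a positive constant for all large R.
  have hconst : IntegrableOn (fun _ : ℝ => ‖L - L'‖ / 2) (Set.Ici R₀) := by
    refine Integrable.mono' hSint'.integrableOn aestronglyMeasurable_const ?_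
    filter_upwards [ae_restrict_mem measurableSet_Ici] with R hR
    rw [Real.norm_of_nonneg (by positivity)]
    exact (hR₀ R hR).le.trans (hbound R)
  rw [integrableOn_const_iff] at hconst
  simp [hpos.ne'] at hconst

/-- The Cauchy integral of a Hardy class function vanishes in the lower half-plane. -/
lemma MemHardyPlus.integral_eq_zero {f : ℝ → ℂ} (hf : MemHardyPlus f) {l : ℂ} (hl : l.im < 0) :
    ∫ x : ℝ, f x * ((x : ℂ) - l)⁻¹ = 0 := by
  obtain ⟨hf2, F, hF, ⟨C, hC⟩, hlim⟩ := hf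
  have hline : ∀ y : ℝ, 0 < y → MemLp (fun x : ℝ => F ((x : ℂ) + (y : ℂ) * I)) 2 volume := by
    intro y hy
    have hc : Continuous fun x : ℝ => F ((x : ℂ) + (y : ℂ) * I) :=
      hF.continuousOn.comp_continuous (by fun_prop) fun x => by simpa using hy
    exact ⟨hc.aestronglyMeasurable, (hC y hy).trans_lt ENNReal.coe_lt_top⟩
  have him : ∀ y : ℝ, 0 < y → -l.im + y ≤ |(l - y * I).im| := by
    intro y hy
    refine le_trans ?_ (neg_le_abs _)
    simp
  have him0 : ∀ y : ℝ, 0 < y → (l - y * I).im ≠ 0 := by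
    intro y hy
    exact abs_pos.1 (lt_of_lt_of_le (by linarith) (him y hy))
  have hnorm : ∀ (y : ℝ) (hy : 0 < y), ‖(hline y hy).toLp _‖ ≤ C := by
    intro y hy
    rw [Lp.norm_toLp]
    exact ENNReal.toReal_le_of_le_ofReal C.2 (by simpa using hC y hy)
  -- Since l is in the lower half-plane, k is holomorphic above the real axis. Its integral over the
  -- line at height y pairs F with the kernel at l - iy, whose norm decays as y grows, so the
  -- constant line integral is 0.
  set k : ℂ → ℂ := fun z => F z * (z - l)⁻¹ with hk
  have hkd : DifferentiableOn ℂ k {z : ℂ | 0 < z.im} := by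
    refine hF.mul (DifferentiableOn.inv (by fun_prop) fun z hz h => ?_)
    have := congrArg Complex.im h
    simp only [Complex.sub_im, Complex.zero_im] at this
    have hz' : 0 < z.im := hz
    linarith
  have hkline : ∀ y x : ℝ, k ((x : ℂ) + (y : ℂ) * I)
      = F ((x : ℂ) + (y : ℂ) * I) * ((x : ℂ) - (l - y * I))⁻¹ := by
    intro y x
    simp only [hk]
    congr 2
    ring
  have hkint : ∀ y : ℝ, 0 < y → Integrable fun x : ℝ => k ((x : ℂ) + (y : ℂ) * I) := by
    intro y hy
    simp_rw [hkline]
    exact (hline y hy).integrable_mul (memLp_resolventKernel (him0 y hy))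
  have hJ : ∀ (y : ℝ) (hy : 0 < y), ∫ x : ℝ, k ((x : ℂ) + (y : ℂ) * I)
      = pairing ((hline y hy).toLp _) (resolventKernel (l - y * I)) := by
    intro y hy
    simp_rw [hkline]
    exact integral_mul_resolventKernel (hline y hy) (him0 y hy)
  have hM : ∀ y : ℝ, 0 < y → ∫ x : ℝ, ‖k ((x : ℂ) + (y : ℂ) * I)‖ ≤ C * √(Real.pi / -l.im) := by
    intro y hy
    simp_rw [hkline]
    refine (integral_norm_mul_le (hline y hy) (memLp_resolventKernel (him0 y hy))).trans ?_
    have h1 : (memLp_resolventKernel (him0 y hy)).toLp _ = resolventKernel (l - y * I) := by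
      rw [resolventKernel, dif_pos (him0 y hy)]
    rw [h1]
    exact mul_le_mul (hnorm y hy)
      (norm_resolventKernel_le_of_le (by linarith) (le_trans (by linarith) (him y hy)))
      (norm_nonneg _) C.2
  have hconst : ∀ y₁ y₂ : ℝ, 0 < y₁ → y₁ ≤ y₂ → ∫ x : ℝ, k ((x : ℂ) + (y₁ : ℂ) * I)
      = ∫ x : ℝ, k ((x : ℂ) + (y₂ : ℂ) * I) := fun y₁ y₂ h1 h2 =>
    integral_line_eq hkd h1 h2 hkint hM
  have hinf : Tendsto (fun y : ℝ => ∫ x : ℝ, k ((x : ℂ) + (y : ℂ) * I)) atTop (𝓝 0) := by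
    have h1 : Tendsto (fun y : ℝ => (C : ℝ) * √(Real.pi / (-l.im + y))) atTop (𝓝 0) := by
      have h2 : Tendsto (fun y : ℝ => Real.pi / (-l.im + y)) atTop (𝓝 0) :=
        tendsto_const_nhds.div_atTop (tendsto_atTop_add_const_left _ _ tendsto_id)
      simpa using h2.sqrt.const_mul (C : ℝ)
    refine squeeze_zero_norm' ?_ h1
    filter_upwards [eventually_gt_atTop 0] with y hy
    rw [hJ y hy]
    refine (norm_pairing_le _ _).trans ?_
    exact mul_le_mul (hnorm y hy) (norm_resolventKernel_le_of_le (by linarith) (him y hy))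
      (norm_nonneg _) C.2
  have hzero : ∀ y : ℝ, 0 < y → ∫ x : ℝ, k ((x : ℂ) + (y : ℂ) * I) = 0 := by
    intro y hy
    refine tendsto_nhds_unique (tendsto_const_nhds.congr' ?_) hinf
    filter_upwards [eventually_ge_atTop y] with y' hy'
    exact hconst y y' hy hy'
  rw [integral_mul_resolventKernel hf2 hl.ne]
  have h0 : Tendsto (fun y : ℝ => ‖resolventKernel (l - y * I) - resolventKernel l‖) (𝓝[>] 0)
      (𝓝 0) := by
    have h1 : Tendsto (fun y : ℝ => l - y * I) (𝓝[>] 0) (𝓝 l) := by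
      have : Continuous fun y : ℝ => l - y * I := by fun_prop
      simpa using (this.tendsto 0).mono_left nhdsWithin_le_nhds
    exact tendsto_iff_norm_sub_tendsto_zero.1 ((continuousAt_resolventKernel hl.ne).tendsto.comp h1)
  have h1 : Tendsto (fun y : ℝ => (C : ℝ) * ‖resolventKernel (l - y * I) - resolventKernel l‖
      + (eLpNorm (fun x : ℝ => F ((x : ℂ) + (y : ℂ) * I) - f x) 2 volume).toReal
        * ‖resolventKernel l‖) (𝓝[>] 0) (𝓝 0) := by
    have h2 := (ENNReal.tendsto_toReal ENNReal.zero_ne_top).comp hlim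
    simpa using (h0.const_mul (C : ℝ)).add (h2.mul_const ‖resolventKernel l‖)
  have h3 : ‖pairing (hf2.toLp f) (resolventKernel l)‖ ≤ 0 := by
    refine ge_of_tendsto h1 ?_
    filter_upwards [self_mem_nhdsWithin] with y hy
    have hy' : (0 : ℝ) < y := hy
    have h4 := hJ y hy'
    rw [hzero y hy', pairing_comm] at h4
    -- Subtract the vanishing integral at height y: one error comes from shifting the pole from l to
    -- l - iy, the other from the L² convergence of F to f, and both tend to 0 with y.
    have h5 : pairing (hf2.toLp f) (resolventKernel l)
        = -(pairing ((hline y hy').toLp _) (resolventKernel (l - y * I) - resolventKernel l)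
          + pairing ((hline y hy').toLp _ - hf2.toLp f) (resolventKernel l)) := by
      rw [map_sub, pairing_comm ((hline y hy').toLp _ - hf2.toLp f), map_sub,
        pairing_comm _ (resolventKernel (l - y * I)), ← h4, pairing_comm (hf2.toLp f),
        pairing_comm (resolventKernel l) ((hline y hy').toLp _)]
      ring
    rw [h5, norm_neg]
    refine (norm_add_le _ _).trans (add_le_add ((norm_pairing_le _ _).trans ?_)
      ((norm_pairing_le _ _).trans ?_))
    · exact mul_le_mul_of_nonneg_right (hnorm y hy') (norm_nonneg _)
    · rw [← MemLp.toLp_sub, Lp.norm_toLp]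
      exact le_rfl
  exact norm_le_zero_iff.1 h3


/-! ### Functions with one-sided vanishing Cauchy integral. -/

/-- For `s = 1` (`s = -1`), the functions in `L²(ℝ)` whose Cauchy integrals vanish in the lower
(upper) half-plane. -/
def CauchyVanishes (s : ℝ) (h : L2) : Prop :=
  ∀ l : ℂ, s * l.im < 0 → pairing h (resolventKernel l) = 0

lemma MemHardyPlus.cauchyVanishes {f : ℝ → ℂ} (hf : MemHardyPlus f) {h : L2}
    (hfh : h =ᵐ[volume] f) : CauchyVanishes 1 h := by
  intro l hl
  rw [one_mul] at hl
  rw [pairing_apply, ← hf.integral_eq_zero hl]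
  refine integral_congr_ae ?_
  filter_upwards [hfh, coeFn_resolventKernel hl.ne] with x h1 h2
  rw [h1, h2]

lemma CauchyVanishes.star_neg {s : ℝ} {h : L2} (hh : CauchyVanishes s h) :
    CauchyVanishes (-s) (star h) := by
  intro l hl
  have hl0 : l.im ≠ 0 := right_ne_zero_of_mul hl.ne
  have h1 := hh (conj l) (by simpa using hl)
  rw [← star_resolventKernel hl0] at h1
  have h2 := pairing_star_star h (star (resolventKernel l))
  rw [star_star, h1, map_zero] at h2
  exact h2

lemma sign_mul_self {s : ℝ} (hs : s = 1 ∨ s = -1) : s * s = 1 := by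
  rcases hs with rfl | rfl <;> norm_num

lemma neg_sign {s : ℝ} (hs : s = 1 ∨ s = -1) : -s = 1 ∨ -s = -1 := by
  rcases hs with rfl | rfl <;> simp

/-- The vanishing of a Cauchy integral extends over a single point. -/
lemma pairing_resolventKernel_eq_zero_of_ne {s : ℝ} (h : L2) {l : ℂ} (hl : s * l.im < 0)
    (h0 : ∀ m : ℂ, s * m.im < 0 → m ≠ l → pairing h (resolventKernel m) = 0) :
    pairing h (resolventKernel l) = 0 := by
  have hl0 : l.im ≠ 0 := right_ne_zero_of_mul hl.ne
  have h1 : Tendsto (fun m => pairing h (resolventKernel m)) (𝓝[≠] l)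
      (𝓝 (pairing h (resolventKernel l))) :=
    ((((pairing h).continuous.tendsto _).comp
      (continuousAt_resolventKernel hl0).tendsto)).mono_left nhdsWithin_le_nhds
  refine tendsto_nhds_unique h1 (tendsto_const_nhds.congr' ?_)
  have h2 : ∀ᶠ m in 𝓝 l, s * m.im < 0 :=
    (continuous_const.mul Complex.continuous_im).continuousAt.eventually_lt_const hl
  filter_upwards [nhdsWithin_le_nhds h2, self_mem_nhdsWithin] with m hm hne
  exact (h0 m hm hne).symm

lemma cauchyVanishes_resolventKernel {s : ℝ} (hs : s = 1 ∨ s = -1) {l : ℂ} (hl : s * l.im < 0) :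
    CauchyVanishes s (resolventKernel l) := by
  have hl0 : l.im ≠ 0 := right_ne_zero_of_mul hl.ne
  have hne : ∀ m : ℂ, s * m.im < 0 → m ≠ l → pairing (resolventKernel l) (resolventKernel m) = 0 := by
    intro m hm hne
    have h1 := mul_pairing_resolventKernel (right_ne_zero_of_mul hm.ne) hl0
      (traceOne_resolventKernel (l := m) (neg_sign hs) (by linarith))
      (traceOne_resolventKernel (l := l) (neg_sign hs) (by linarith))
    rw [sub_self] at h1
    exact (mul_eq_zero.1 h1).resolve_left (sub_ne_zero.2 hne)
  intro m hm
  rcases eq_or_ne m l with rfl | h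
  · exact pairing_resolventKernel_eq_zero_of_ne _ hm hne
  · exact hne m hm h

/-- The transform of h/(x - l) at m is (ĥ(l) - ĥ(m))/(l - m), and both values vanish on this side.
-/
lemma CauchyVanishes.divSub_of_neg {s : ℝ} {h : L2} (hh : CauchyVanishes s h) {l : ℂ}
    (hl : s * l.im < 0) : CauchyVanishes s (divSub l h) := by
  have hl0 : l.im ≠ 0 := right_ne_zero_of_mul hl.ne
  have hne : ∀ m : ℂ, s * m.im < 0 → m ≠ l → pairing (divSub l h) (resolventKernel m) = 0 := by
    intro m hm hne
    have h1 := mul_pairing_divSub_resolventKernel h hl0 (right_ne_zero_of_mul hm.ne)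
    rw [hh l hl, hh m hm, sub_zero, pairing_divSub hl0] at h1
    exact (mul_eq_zero.1 h1).resolve_left (sub_ne_zero.2 hne.symm)
  intro m hm
  rcases eq_or_ne m l with rfl | h
  · exact pairing_resolventKernel_eq_zero_of_ne _ hm hne
  · exact hne m hm h

/-- Division by x - l creates a pole on the analytic side; subtracting the multiple of 1/(x - l)
with the same residue brings the function back into the class. Pairing this with the isotropy of the
class gives multiplicativity. -/
lemma CauchyVanishes.divSub_sub_of_pos {s : ℝ} (hs : s = 1 ∨ s = -1) {h : L2}
    (hh : CauchyVanishes s h) {l : ℂ} (hl : 0 < s * l.im) :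
    CauchyVanishes s ((2 * s * Real.pi * I : ℂ) • divSub l h
      - pairing h (resolventKernel l) • resolventKernel l) := by
  intro m hm
  have hl0 : l.im ≠ 0 := right_ne_zero_of_mul hl.ne'
  have hm0 : m.im ≠ 0 := right_ne_zero_of_mul hm.ne
  have hne : l - m ≠ 0 := by
    refine sub_ne_zero.2 ?_
    rintro rfl
    linarith
  have h1 := mul_pairing_divSub_resolventKernel h hl0 hm0
  rw [hh m hm, sub_zero, pairing_divSub hl0] at h1
  have h2 := mul_pairing_resolventKernel hl0 hm0 (traceOne_resolventKernel hs hl)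
    (traceOne_resolventKernel (l := m) (neg_sign hs) (by linarith))
  apply mul_left_cancel₀ hne
  rw [pairing_comm, map_sub, map_smul, map_smul, pairing_comm _ (divSub l h), smul_eq_mul,
    smul_eq_mul]
  push_cast at h2
  linear_combination (2 * s * Real.pi * I : ℂ) * h1 - pairing h (resolventKernel l) * h2

/-- The class of functions whose Cauchy integrals vanish in a half-plane is isotropic. -/
lemma CauchyVanishes.pairing_eq_zero {s : ℝ} (hs : s = 1 ∨ s = -1) {h w : L2}
    (hh : CauchyVanishes s h) (hw : CauchyVanishes s w) : pairing h w = 0 := by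
  -- K plays the role of the complementary Hardy space. The class is contained in Kᗮ, because
  -- conjugation reflects the pole, while conj h lies in the closure of K, so ∫ h w = ⟨w, conj h⟩ =
  -- 0.
  set K : Submodule ℂ L2 :=
    (Submodule.span ℂ {v | ∃ m : ℂ, 0 < s * m.im ∧ v = resolventKernel m}) with hK
  have hmem : ∀ v : L2, CauchyVanishes s v → v ∈ Kᗮ := by
    intro v hv
    rw [hK, Submodule.mem_orthogonal]
    intro u hu
    induction hu using Submodule.span_induction with
    | mem u hu =>
      obtain ⟨m, hm, rfl⟩ := hu
      have hm0 : m.im ≠ 0 := right_ne_zero_of_mul hm.ne'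
      rw [inner_eq_pairing, star_resolventKernel hm0, pairing_comm]
      exact hv _ (by simpa using hm)
    | zero => simp
    | add x y _ _ hx hy => rw [inner_add_left, hx, hy, add_zero]
    | smul c x _ hx => rw [inner_smul_left, hx, mul_zero]
  have hw' : w ∈ Kᗮ := hmem w hw
  have hlow : ∀ l : ℂ, s * l.im < 0 → resolventKernel l ∈ Kᗮ := fun l hl =>
    hmem _ (cauchyVanishes_resolventKernel hs hl)
  have hh' : star h ∈ K.topologicalClosure := by
    obtain ⟨k, hk, k', hk', hsum⟩ :=
      Submodule.exists_add_mem_mem_orthogonal (K := K.topologicalClosure) (star h)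
    rw [Submodule.orthogonal_closure] at hk'
    have hcl : K.topologicalClosure ≤ Kᗮᗮ := by
      rw [Submodule.orthogonal_orthogonal_eq_closure]
    -- The component k' of conj h orthogonal to K is also orthogonal to the kernels with poles in
    -- the other half-plane, since conj h and the closure of K are; totality then kills it.
    have hzero : star k' = 0 := by
      refine eq_zero_of_pairing_resolventKernel fun l hl => ?_
      rw [← inner_eq_pairing]
      rcases lt_or_gt_of_ne (mul_ne_zero (show s ≠ 0 by rcases hs with rfl | rfl <;> norm_num) hl)
        with h1 | h1
      · have h2 : k' = star h - k := by rw [hsum]; abel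
        rw [h2, inner_sub_left, inner_eq_pairing, star_star, hh l h1,
          Submodule.inner_left_of_mem_orthogonal (hlow l h1) (hcl hk), sub_zero]
      · have h2 : resolventKernel l ∈ K := Submodule.subset_span ⟨l, h1, rfl⟩
        exact Submodule.inner_left_of_mem_orthogonal h2 hk'
    have hk0 : k' = 0 := by rw [← star_star k', hzero, star_zero_L2]
    rw [hsum, hk0, add_zero]
    exact hk
  rw [← star_star h, ← inner_eq_pairing]
  rw [← Submodule.orthogonal_closure] at hw'
  exact Submodule.inner_right_of_mem_orthogonal hh' hw'

/-- Multiplicativity of the Cauchy integral. -/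
lemma CauchyVanishes.pairing_divSub {s : ℝ} (hs : s = 1 ∨ s = -1) {h w : L2}
    (hh : CauchyVanishes s h) (hw : CauchyVanishes s w) {l : ℂ} (hl : 0 < s * l.im) :
    (2 * s * Real.pi * I : ℂ) * pairing h (divSub l w)
      = pairing h (resolventKernel l) * pairing w (resolventKernel l) := by
  have h1 := hh.pairing_eq_zero hs (hw.divSub_sub_of_pos hs hl)
  rw [map_sub, map_smul, map_smul, smul_eq_mul, smul_eq_mul] at h1
  linear_combination h1

lemma isOpen_halfPlane (s : ℝ) : IsOpen {z : ℂ | 0 < s * z.im} :=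
  isOpen_lt continuous_const (continuous_const.mul Complex.continuous_im)

/-- Identity theorem for the Cauchy transform, which is holomorphic on the connected half-plane. -/
lemma pairing_resolventKernel_eq_zero_of_eventually {s : ℝ} {h : L2} {z₀ : ℂ}
    (hz₀ : 0 < s * z₀.im) (h0 : ∀ᶠ z in 𝓝 z₀, pairing h (resolventKernel z) = 0) {z : ℂ}
    (hz : 0 < s * z.im) : pairing h (resolventKernel z) = 0 := by
  have hconv : Convex ℝ {z : ℂ | 0 < s * z.im} := by
    have : {z : ℂ | 0 < s * z.im} = (s • Complex.imLm) ⁻¹' Set.Ioi 0 := by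
      ext z; simp
    rw [this]
    exact (convex_Ioi (0 : ℝ)).linear_preimage _
  have hd : DifferentiableOn ℂ (fun z => pairing h (resolventKernel z)) {z : ℂ | 0 < s * z.im} :=
    fun z hz => (differentiableAt_pairing_resolventKernel h
      (right_ne_zero_of_mul (ne_of_gt hz))).differentiableWithinAt
  exact (hd.analyticOnNhd (isOpen_halfPlane s)).eqOn_zero_of_preconnected_of_eventuallyEq_zero
    hconv.isPreconnected hz₀ h0 hz

/-! ### Determinant and solutions in each half-plane. -/

lemma resolventDet_of_neg {s : ℝ} (hs : s = 1 ∨ s = -1) {φ ψ : L2} {B a l : ℂ}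
    (hφ : CauchyVanishes s (star φ)) (hψ : CauchyVanishes s ψ) (hl : s * l.im < 0) :
    resolventDet φ ψ B a l = a - B := by
  rw [resolventDet, hφ.pairing_eq_zero hs (hψ.divSub_of_neg hl), hφ l hl]
  ring

lemma mul_resolventDet_of_pos {s : ℝ} (hs : s = 1 ∨ s = -1) {φ ψ : L2} {B a l : ℂ}
    (hφ : CauchyVanishes s (star φ)) (hψ : CauchyVanishes s ψ) (hl : 0 < s * l.im) :
    (2 * s * Real.pi * I : ℂ) * resolventDet φ ψ B a l = (2 * s * Real.pi * I : ℂ) * (a - B)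
      + (a - B - 2 * s * Real.pi * I) *
        (pairing (star φ) (resolventKernel l) * pairing ψ (resolventKernel l)) := by
  rw [resolventDet]
  linear_combination (a - B) * hφ.pairing_divSub hs hψ hl

lemma exists_pairing_ne_zero {s : ℝ} (hs : s = 1 ∨ s = -1) {h : L2} (hh : CauchyVanishes s h)
    (h0 : h ≠ 0) : ∃ z : ℂ, 0 < s * z.im ∧ pairing h (resolventKernel z) ≠ 0 := by
  by_contra! hcon
  refine h0 (eq_zero_of_pairing_resolventKernel fun l hl => ?_)
  have hs0 : s ≠ 0 := by rcases hs with rfl | rfl <;> norm_num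
  rcases lt_or_gt_of_ne (mul_ne_zero hs0 hl) with h1 | h1
  · exact hh l h1
  · exact hcon l h1

lemma im_sign_mul_I (s y : ℝ) : (((s * y : ℝ) : ℂ) * I).im = s * y := by simp

/-- If the determinant vanished throughout, its limit s·πi - B at infinity would be 0. In that
critical case it equals minus the product of two Cauchy transforms, and neither factor vanishes
identically. -/
lemma exists_resolventDet_ne_zero {s : ℝ} (hs : s = 1 ∨ s = -1) {φ ψ : L2} {B : ℂ}
    (hφ : CauchyVanishes s (star φ)) (hψ : CauchyVanishes s ψ)
    (hB : B = s * Real.pi * I → φ ≠ 0 ∧ ψ ≠ 0) :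
    ∃ z : ℂ, 0 < s * z.im ∧ resolventDet φ ψ B (s * Real.pi * I) z ≠ 0 := by
  have hs0 : s ≠ 0 := by rcases hs with rfl | rfl <;> norm_num
  have hpi : (Real.pi : ℂ) ≠ 0 := by exact_mod_cast Real.pi_ne_zero
  have hsc : (s : ℂ) ≠ 0 := by exact_mod_cast hs0
  have htp : (2 * s * Real.pi * I : ℂ) ≠ 0 := by simp [hpi, hsc]
  by_contra! hcon
  have hprod : ∀ z : ℂ, 0 < s * z.im →
      (2 * s * Real.pi * I : ℂ) * (s * Real.pi * I - B) + (s * Real.pi * I - B - 2 * s * Real.pi * I) *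
        (pairing (star φ) (resolventKernel z) * pairing ψ (resolventKernel z)) = 0 := by
    intro z hz
    rw [← mul_resolventDet_of_pos hs hφ hψ hz, hcon z hz, mul_zero]
  have hBeq : B = s * Real.pi * I := by
    have h1 := (((tendsto_pairing_resolventKernel hs (star φ)).mul
      (tendsto_pairing_resolventKernel hs ψ)).const_mul
      (s * Real.pi * I - B - 2 * s * Real.pi * I)).const_add
        ((2 * s * Real.pi * I : ℂ) * (s * Real.pi * I - B))
    have h2 : (2 * s * Real.pi * I : ℂ) * (s * Real.pi * I - B) = 0 := by
      rw [mul_zero, mul_zero, add_zero] at h1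
      refine tendsto_nhds_unique h1 (tendsto_const_nhds.congr' ?_)
      filter_upwards [eventually_gt_atTop 0] with y hy
      refine (hprod _ ?_).symm
      rw [im_sign_mul_I, ← mul_assoc, sign_mul_self hs, one_mul]
      exact hy
    exact (sub_eq_zero.1 ((mul_eq_zero.1 h2).resolve_left htp)).symm
  obtain ⟨hφ0, hψ0⟩ := hB hBeq
  have hqp : ∀ z : ℂ, 0 < s * z.im →
      pairing (star φ) (resolventKernel z) * pairing ψ (resolventKernel z) = 0 := by
    intro z hz
    have h1 := hprod z hz
    rw [hBeq, sub_self, mul_zero, zero_add, zero_sub] at h1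
    exact (mul_eq_zero.1 h1).resolve_left (neg_ne_zero.2 htp)
  obtain ⟨z₀, hz₀, hne⟩ := exists_pairing_ne_zero hs hψ hψ0
  have hφ0' : star φ ≠ 0 := fun h => hφ0 (by rw [← star_star φ, h, star_zero_L2])
  obtain ⟨z₁, hz₁, hne₁⟩ := exists_pairing_ne_zero hs hφ hφ0'
  refine hne₁ (pairing_resolventKernel_eq_zero_of_eventually hz₀ ?_ hz₁)
  filter_upwards [(differentiableAt_pairing_resolventKernel ψ
    (right_ne_zero_of_mul hz₀.ne')).continuousAt.eventually_ne hne,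
    (isOpen_halfPlane s).mem_nhds hz₀] with z h1 h2
  exact (mul_eq_zero.1 (hqp z h2)).resolve_right h1

/-- Continuity of the determinant makes its non-vanishing an open condition. -/
lemma eventually_resolventDet_ne_zero {s : ℝ} (hs : s = 1 ∨ s = -1) {φ ψ : L2} {B a z₀ : ℂ}
    (hφ : CauchyVanishes s (star φ)) (hψ : CauchyVanishes s ψ) (hz₀ : 0 < s * z₀.im)
    (hne : resolventDet φ ψ B a z₀ ≠ 0) :
    ∀ᶠ z in 𝓝 z₀, resolventDet φ ψ B a z ≠ 0 := by
  have hs0 : s ≠ 0 := by rcases hs with rfl | rfl <;> norm_num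
  have hpi : (Real.pi : ℂ) ≠ 0 := by exact_mod_cast Real.pi_ne_zero
  have hsc : (s : ℂ) ≠ 0 := by exact_mod_cast hs0
  have htp : (2 * s * Real.pi * I : ℂ) ≠ 0 := by simp [hpi, hsc]
  have hz0 := right_ne_zero_of_mul hz₀.ne'
  have h1 : ContinuousAt (fun z => (2 * s * Real.pi * I : ℂ) * (a - B)
      + (a - B - 2 * s * Real.pi * I) *
        (pairing (star φ) (resolventKernel z) * pairing ψ (resolventKernel z))) z₀ :=
    continuousAt_const.add (continuousAt_const.mul
      ((differentiableAt_pairing_resolventKernel (star φ) hz0).continuousAt.mul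
        (differentiableAt_pairing_resolventKernel ψ hz0).continuousAt))
  have h2 := h1.eventually_ne (y := 0) (by
    rw [← mul_resolventDet_of_pos hs hφ hψ hz₀]
    exact mul_ne_zero htp hne)
  filter_upwards [h2, (isOpen_halfPlane s).mem_nhds hz₀] with z hz hz'
  rw [← mul_resolventDet_of_pos hs hφ hψ hz'] at hz
  exact right_ne_zero_of_mul hz

lemma pairing_kernelSolution_of_neg {s : ℝ} (hs : s = 1 ∨ s = -1) {φ ψ : L2} {B a l : ℂ}
    (hφ : CauchyVanishes s (star φ)) (hψ : CauchyVanishes s ψ) (hl : s * l.im < 0) (G : L2) :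
    pairing G (kernelSolution φ ψ B a l) = (a - B)⁻¹ * pairing G (resolventKernel l) := by
  rw [kernelSolution, resolventDet_of_neg hs hφ hψ hl,
    hφ.pairing_eq_zero hs (hψ.divSub_of_neg hl), hφ l hl, zero_smul, sub_zero, add_zero, one_smul,
    map_smul, smul_eq_mul]

/-- By multiplicativity the terms containing the product of the transforms of conj φ, ψ and G
cancel, so only Ĝ(l) divided by the determinant survives. -/
lemma pairing_kernelSolution_of_pos {s : ℝ} (hs : s = 1 ∨ s = -1) {φ ψ G : L2} {B a l : ℂ}
    (hφ : CauchyVanishes s (star φ)) (hψ : CauchyVanishes s ψ) (hG : CauchyVanishes s G)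
    (hl : 0 < s * l.im) :
    pairing G (kernelSolution φ ψ B a l)
      = (resolventDet φ ψ B a l)⁻¹ * pairing G (resolventKernel l) := by
  have hs0 : s ≠ 0 := by rcases hs with rfl | rfl <;> norm_num
  have hpi : (Real.pi : ℂ) ≠ 0 := by exact_mod_cast Real.pi_ne_zero
  have hsc : (s : ℂ) ≠ 0 := by exact_mod_cast hs0
  have htp : (2 * s * Real.pi * I : ℂ) ≠ 0 := by simp [hpi, hsc]
  rw [kernelSolution, map_smul, smul_eq_mul, map_sub, map_smul, map_smul, smul_eq_mul, smul_eq_mul]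
  congr 1
  apply mul_left_cancel₀ htp
  linear_combination pairing G (resolventKernel l) * hφ.pairing_divSub hs hψ hl
    - pairing (star φ) (resolventKernel l) * hG.pairing_divSub hs hψ hl

/-! ### Vanishing of the orthogonal complement, for either sign. -/

theorem nonempty_resolventSet_and_orthogonal_detectableSpan {s : ℝ} (hs : s = 1 ∨ s = -1)
    {φ ψ : L2} {B : ℂ} (hφ : CauchyVanishes s (star φ)) (hψ : CauchyVanishes s ψ)
    (hB : B ≠ -(s * Real.pi * I)) (hB' : B = s * Real.pi * I → φ ≠ 0 ∧ ψ ≠ 0) :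
    (resolventSet (extOp φ ψ B)).Nonempty ∧
      ∀ μ₀ ∈ resolventSet (extOp φ ψ B), (detectableSpan φ ψ B μ₀)ᗮ = ⊥ := by
  have hss := sign_mul_self hs
  have hs' := neg_sign hs
  have hdet : ∀ l : ℂ, s * l.im < 0 →
      resolventDet φ ψ B ((-s : ℝ) * Real.pi * I) l ≠ 0 := by
    intro l hl
    rw [resolventDet_of_neg hs hφ hψ hl, sub_ne_zero]
    intro h
    apply hB
    rw [← h]
    push_cast
    ring
  have htr : ∀ l : ℂ, s * l.im < 0 → TraceOne (resolventKernel l) ((-s : ℝ) * Real.pi * I) :=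
    fun l hl => traceOne_resolventKernel hs' (by linarith)
  have hneg : ∀ y : ℝ, 0 < y → s * ((((-s) * y : ℝ) : ℂ) * I).im < 0 := by
    intro y hy
    rw [im_sign_mul_I]
    nlinarith
  have him : ∀ l : ℂ, s * l.im < 0 → l.im ≠ 0 := fun l hl => right_ne_zero_of_mul hl.ne
  have him' : ∀ l : ℂ, 0 < s * l.im → l.im ≠ 0 := fun l hl => right_ne_zero_of_mul hl.ne'
  refine ⟨⟨_, mem_resolventSet_of_resolventDet_ne_zero (him _ (hneg 1 one_pos))
    (htr _ (hneg 1 one_pos)) (hdet _ (hneg 1 one_pos))⟩, fun μ₀ hμ₀ => ?_⟩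
  rw [Submodule.eq_bot_iff]
  intro g hg
  set G := star g with hGdef
  have hdiff : ∀ (δ : ℂ) (u v : L2), δ ∈ resolventSet (extOp φ ψ B) → δ ≠ μ₀ →
      IsSolution φ ψ B μ₀ 1 u → IsSolution φ ψ B δ 1 v → pairing G v = pairing G u := by
    rintro δ u v ⟨R, hR⟩ hne hu hv
    have h1 := (Submodule.mem_orthogonal' _ _).1 hg (R u)
      (Submodule.subset_span ⟨δ, R, hR, u, ⟨1, hu⟩, rfl⟩)
    rw [inner_eq_pairing, ← hGdef] at h1
    have h2 := congrArg (pairing G) (resolvent_apply_of_isSolution hR hu hv)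
    rw [map_smul, h1, smul_zero, map_sub] at h2
    exact (sub_eq_zero.1 h2.symm).symm
  -- The common value is found by letting δ tend to infinity along the imaginary axis on the side
  -- where the solution is a fixed multiple of the decaying Cauchy kernel.
  have hsol0 : ∀ u : L2, IsSolution φ ψ B μ₀ 1 u → pairing G u = 0 := by
    intro u hu
    have h1 := (tendsto_pairing_resolventKernel hs' G).const_mul
      (((-s : ℝ) : ℂ) * Real.pi * I - B)⁻¹
    rw [mul_zero] at h1
    refine tendsto_nhds_unique (tendsto_const_nhds.congr' ?_) h1
    filter_upwards [eventually_gt_atTop 0, eventually_gt_atTop ‖μ₀‖] with y hy hy'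
    have hl := hneg y hy
    rw [← pairing_kernelSolution_of_neg hs hφ hψ hl]
    refine (hdiff _ _ _ (mem_resolventSet_of_resolventDet_ne_zero (him _ hl) (htr _ hl)
      (hdet _ hl)) ?_ hu (isSolution_kernelSolution (him _ hl) (htr _ hl) (hdet _ hl))).symm
    rintro rfl
    rw [norm_mul, norm_I, mul_one, Complex.norm_real, norm_mul, Real.norm_of_nonneg hy.le] at hy'
    have : ‖-s‖ = 1 := by rcases hs with rfl | rfl <;> simp
    rw [this, one_mul] at hy'
    exact lt_irrefl _ hy'
  have hsol : ∀ l a : ℂ, l.im ≠ 0 → TraceOne (resolventKernel l) a →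
      resolventDet φ ψ B a l ≠ 0 → pairing G (kernelSolution φ ψ B a l) = 0 := by
    intro l a hl ha hD
    have hv := isSolution_kernelSolution hl ha hD
    rcases eq_or_ne l μ₀ with rfl | hne
    · exact hsol0 _ hv
    · obtain ⟨u, hu⟩ := exists_isSolution hμ₀ hv
      rw [hdiff l u _ (mem_resolventSet_of_resolventDet_ne_zero hl ha hD) hne hu hv, hsol0 u hu]
  have hGs : CauchyVanishes s G := by
    intro l hl
    have h1 := hsol l _ (him l hl) (htr l hl) (hdet l hl)
    rw [pairing_kernelSolution_of_neg hs hφ hψ hl] at h1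
    have h2 := hdet l hl
    rw [resolventDet_of_neg hs hφ hψ hl] at h2
    exact (mul_eq_zero.1 h1).resolve_left (inv_ne_zero h2)
  -- G now belongs to the class, so the formula on the analytic side applies. One point with nonzero
  -- determinant gives a neighbourhood of zeros of Ĝ, and hence Ĝ = 0 on that half-plane.
  obtain ⟨z₀, hz₀, hne⟩ := exists_resolventDet_ne_zero hs hφ hψ hB'
  have hev : ∀ᶠ z in 𝓝 z₀, pairing G (resolventKernel z) = 0 := by
    filter_upwards [eventually_resolventDet_ne_zero hs hφ hψ hz₀ hne,
      (isOpen_halfPlane s).mem_nhds hz₀] with z hz hz'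
    have h1 := hsol z _ (him' z hz') (traceOne_resolventKernel hs hz') hz
    rw [pairing_kernelSolution_of_pos hs hφ hψ hGs hz'] at h1
    exact (mul_eq_zero.1 h1).resolve_left (inv_ne_zero hz)
  have hG0 : G = 0 := by
    by_contra h0
    obtain ⟨z, hz, hz'⟩ := exists_pairing_ne_zero hs hGs h0
    exact hz' (pairing_resolventKernel_eq_zero_of_eventually hz₀ hev hz)
  rw [← star_star g, ← hGdef, hG0, star_zero_L2]

lemma defect_eq_zero_and_closure_eq_top {S : Submodule ℂ L2} (hS : Sᗮ = ⊥) :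
    defect S = 0 ∧ S.topologicalClosure = ⊤ := by
  refine ⟨?_, Submodule.topologicalClosure_eq_top_iff.2 hS⟩
  rw [defect, hS, rank_bot]

end Friedrichs

/-! ### The two halves of the theorem: s = 1, and s = -1 with φ and ψ exchanged. -/

theorem mainTheorem8 (φ ψ : Friedrichs.L2)
    (hφ : Friedrichs.MemHardyPlus (fun x => conj (φ x)))
    (hψ : Friedrichs.MemHardyPlus (fun x => ψ x))
    (B : ℂ) (hB : B ≠ -(Real.pi * I))
    (hnontrivial : B = Real.pi * I → φ ≠ 0 ∧ ψ ≠ 0) :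
    ((Friedrichs.resolventSet (Friedrichs.extOp φ ψ B)).Nonempty ∧
      ∀ μ₀ ∈ Friedrichs.resolventSet (Friedrichs.extOp φ ψ B),
        Friedrichs.defect (Friedrichs.detectableSpan φ ψ B μ₀) = 0 ∧
        (Friedrichs.detectableSpan φ ψ B μ₀).topologicalClosure = ⊤) ∧
    ((Friedrichs.resolventSet (Friedrichs.extOp ψ φ (conj B))).Nonempty ∧
      ∀ μ₀ ∈ Friedrichs.resolventSet (Friedrichs.extOp ψ φ (conj B)),
        Friedrichs.defect (Friedrichs.detectableSpan ψ φ (conj B) μ₀) = 0 ∧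
        (Friedrichs.detectableSpan ψ φ (conj B) μ₀).topologicalClosure = ⊤) := by
  have hφ' : Friedrichs.CauchyVanishes 1 (star φ) := hφ.cauchyVanishes (Lp.coeFn_star φ)
  have hψ' : Friedrichs.CauchyVanishes 1 ψ := hψ.cauchyVanishes EventuallyEq.rfl
  have hφ'' : Friedrichs.CauchyVanishes (-1) φ := by simpa using hφ'.star_neg
  have h1 := Friedrichs.nonempty_resolventSet_and_orthogonal_detectableSpan (Or.inl rfl) hφ' hψ'
    (B := B) (by simpa using hB) (by simpa using hnontrivial)
  -- For s = -1 the excluded value of conj B is πi and the critical one is -πi; conjugation turns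
  -- these into the same values -πi and πi for B.
  have h2 := Friedrichs.nonempty_resolventSet_and_orthogonal_detectableSpan (Or.inr rfl)
    hψ'.star_neg hφ'' (B := conj B)
    (fun h => hB (by simpa using congrArg conj h))
    (fun h => (hnontrivial (by simpa using congrArg conj h)).symm)
  exact ⟨⟨h1.1, fun μ₀ hμ₀ => Friedrichs.defect_eq_zero_and_closure_eq_top (h1.2 μ₀ hμ₀)⟩,
    ⟨h2.1, fun μ₀ hμ₀ => Friedrichs.defect_eq_zero_and_closure_eq_top (h2.2 μ₀ hμ₀)⟩⟩
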